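/- Consider Burgers' equation $\partial_t u+u\,\partial_x u=0$ on $\mathbb R$. For $\alpha,\rho\in\mathbb R$, $\rho>0$, let $B_{\alpha,\rho}$ be the Banach space of real functions $f$ all of whose derivatives are in $L^2(\mathbb R)$ with $$\|f\|_{B_{\alpha,\rho}}=\sum_{n=0}^\infty \frac{\|D^nf\|_{L^2}}{n!}\,n^\alpha\rho^n<\infty ,$$ where, here and below, $n^\alpha$ is read as $1$ for $n=0$. Put $\|f\|_{H^2}=\sum_{n=0}^{2}\|D^nf\|_{L^2}$. A solution on $[0,S]$ in $B_{\alpha,\rho}$ with data $u^{(0)}$ means $u\in C^1([0,S],B_{\alpha,\rho})$ that satisfies the equation on $[0,S]\times\mathbb R$ and $u(0,\cdot)=u^{(0)}$. **Theorem.** There is an absolute constant $c>0$ such that for all $\alpha>2$, $\rho_0>0$, $c_0>1$ there are constants $c_3\ge c_0$ and $c_4>0$, depending only on $\alpha,\rho_0,c_0$, and for all $\Theta>0$, $M>0$ there are $\rho''\in(0,\rho_0)$, $\delta>0$ and $C\ge c_0M$, depending only on $\alpha,\rho_0,c_0,\Theta,M$, such that the following holds for every $u^{(0)}\in B_{\alpha,\rho_0}$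 with $\|u^{(0)}\|_{B_{\alpha,\rho_0}}\le M$. 1. For every $\rho\in(0,\rho_0)$ there are $T_a>0$ and a solution on $[0,T_a]$ in $B_{\alpha,\rho}$ with data $u^{(0)}$. 2. Let $0<T\le\Theta$ with $c\,c_0\,\|u^{(0)}\|_{H^2}\,T\le\log c_0$, let $T_a>0$ and $\rho>0$ be arbitrary, let $u$ be a solution on $[0,T_a]$ in $B_{\alpha,\rho}$ with data $u^{(0)}$, and put $T'=\min(T_a,T)$. Then $u\in C^1([0,T'],B_{\alpha,\rho''})$, each $u(t,\cdot)$ with $t\in[0,T']$ is real analytic on $\mathbb R$, and $$\sup_{t\in[0,T']}\|u(t,\cdot)\|_{B_{\alpha,\rho''}}\le c_4\|u^{(0)}\|_{B_{\alpha,\rho_0}},\qquad \sup_{t\in[0,T']}\|u(t,\cdot)\|_{H^2}\le c_0\|u^{(0)}\|_{H^2}.$$ Moreover, with $\gamma_0=\sup_{t\in[0,T']}\|u(t,\cdot)\|_{H^2}$, $\gamma=\gamma_0+\delta$ and $C_0=c_3\|u^{(0)}\|_{B_{\alpha,\rho_0}}$, for all $t\in[0,T']$ and all $J\ge0$, $$\|D^Ju(t,\cdot)\|_{L^2}\le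 C_0\,e^{\max(J-2,0)\gamma t}\,\frac{J!}{J^\alpha}\,\frac1{\rho_0^J}\qquad\text{and}\qquad \|D^Ju(t,\cdot)\|_{L^2}\le C\,e^{(J-2)\gamma t}\,\frac{J!}{J^\alpha}\,\frac1{\rho_0^J}.$$ In particular $\rho''$ does not depend on $T_a$. -/

import Mathlib

open Filter Topology MeasureTheory Set

noncomputable section

namespace Burgers

/-- The `L²(ℝ)` norm of a real function (meaningful when the function is in `L²`). -/
def L2Norm (f : ℝ → ℝ) : ℝ := (eLpNorm f 2 volume).toReal

/-- The `L²` norm `‖D^n f‖` of the `n`-th derivative. -/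
def derivNorm (n : ℕ) (f : ℝ → ℝ) : ℝ := L2Norm (iteratedDeriv n f)

/-- The Sobolev norm `‖f‖_{H²} = ∑_{n ≤ 2} ‖D^n f‖_{L²}`. -/
def H2Norm (f : ℝ → ℝ) : ℝ := ∑ n ∈ Finset.range 3, derivNorm n f

/-- The weight `n ^ α`, read as `1` for `n = 0` (with the value `0` there the expression `BNorm`
would lose the `L²` norm of `f` itself and would not give a Banach space). -/
def weight (α : ℝ) (n : ℕ) : ℝ := ((max n 1 : ℕ) : ℝ) ^ α

/-- The `n`-th term of the series that defines the norm of `B_{α,ρ}`. -/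
def BTerm (α ρ : ℝ) (f : ℝ → ℝ) (n : ℕ) : ℝ :=
  derivNorm n f / (n.factorial : ℝ) * weight α n * ρ ^ n

/-- Membership in `B_{α,ρ}`: all derivatives are in `L²(ℝ)` and the norm series converges.
Functions with all weak derivatives in `L²(ℝ)` are smooth after a change on a null set,
so nothing is lost by working with smooth functions. -/
structure MemB (α ρ : ℝ) (f : ℝ → ℝ) : Prop where
  smooth : ContDiff ℝ (⊤ : ℕ∞) f
  memLp : ∀ n : ℕ, MemLp (iteratedDeriv n f) 2 volume
  summable : Summable (BTerm α ρ f)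

/-- The norm of `B_{α,ρ}`: `∑_n ‖D^n f‖_{L²} / n! * n^α * ρ^n`. -/
def BNorm (α ρ : ℝ) (f : ℝ → ℝ) : ℝ := ∑' n : ℕ, BTerm α ρ f n

/-- `u ∈ C¹([0,T], B_{α,ρ})` with time derivative `v`: difference quotients of `u` (one-sided at
the end points) converge to `v` in the norm of `B_{α,ρ}`, and `v` is continuous in that norm. -/
structure IsC1Curve (α ρ T : ℝ) (u v : ℝ → ℝ → ℝ) : Prop where
  mem : ∀ t ∈ Icc 0 T, MemB α ρ (u t)
  mem_deriv : ∀ t ∈ Icc 0 T, MemB α ρ (v t)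
  hasDeriv : ∀ t ∈ Icc 0 T,
    Tendsto (fun s => BNorm α ρ (fun x => (u s x - u t x) / (s - t) - v t x))
      (𝓝[Icc 0 T \ {t}] t) (𝓝 0)
  continuous_deriv : ∀ t ∈ Icc 0 T,
    Tendsto (fun s => BNorm α ρ (fun x => v s x - v t x)) (𝓝[Icc 0 T] t) (𝓝 0)

/-- `u ∈ C¹([0,T], B_{α,ρ})` solves `∂ₜu + u ∂ₓu = 0` on `[0,T]` with `u(0,·) = u₀`. -/
def IsSolution (α ρ T : ℝ) (u₀ : ℝ → ℝ) (u : ℝ → ℝ → ℝ) : Prop :=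
  u 0 = u₀ ∧ ∃ v : ℝ → ℝ → ℝ, IsC1Curve α ρ T u v ∧
    ∀ t ∈ Icc 0 T, ∀ x : ℝ, v t x + u t x * deriv (u t) x = 0

/-- `γ₀ = sup_{t ∈ [0,T]} ‖u(t,·)‖_{H²}`. -/
def supH2 (T : ℝ) (u : ℝ → ℝ → ℝ) : ℝ := sSup ((fun t => H2Norm (u t)) '' Icc 0 T)

end Burgers

end

/-!
# Analytic solutions of Burgers' equation: local existence and a uniform radius

*A priori bounds.* Along a `C¹` curve in `B_{α,ρ}` each `t ↦ D^J u(t)` is a differentiable curve in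
the Hilbert space `L²(ℝ)`, so `‖D^J u‖²` can be differentiated (`hasDerivWithinAt_derivNorm_sq`).
In `D^J (u ∂ₓu)` the term with `J + 1` derivatives is integrated by parts and costs only the slope
`sup |∂ₓu|` (`energy_le`). For `J ≤ 2` nothing but the slope occurs, and the slope is bounded by
`‖u‖_{H²}`; hence on a time interval of length `≲ 1 / ‖u₀‖_{H²}` the slope is under control
(`slope_le`) and the first three energies grow at most by the factor `c₀` (`derivNorm_le_of_le_two`).

For `J ≥ 3` the remaining products `D^k u D^l u`, `k + l = J + 1`, `k, l ≥ 2`, are estimated with the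
bounds `A e^{(J-2)Δt} J! / J^α / ρ₀^J` that are to be proved. The powers of the exponential
add up to exactly `J - 2`, and because `∑ k^{1-α}` converges for `α > 2` the whole sum is at most a
constant times `J` times the bound at level `J` (`exists_convolutionBound`, `energy_high`). The time
derivative of the bound is `(J - 2) Δ` times the bound, so for `Δ` large, depending on the size of the
data only, no derivative can be the first to cross its barrier (`derivNorm_le_exp`). This `Δ` is
`γ = γ₀ + δ`, and the growth of the exponential over `[0, Θ]` shrinks the radius from `ρ₀` by a
factor that depends on the constants only.

*Passing to the radius `ρ''`.* The solution was `C¹` in some `B_{α,ρ}` whose `ρ` may be tiny; this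
gives convergence of difference quotients for each single derivative. The bounds above dominate
the norm series of radius `ρ''` uniformly in time, and dominated convergence (`change_radius`)
yields `C¹` in `B_{α,ρ''}`.

*Existence.* The solution is the series `∑ t^n w_n` with `w_{n+1} = - D (∑ w_a w_b) / (2(n+1))`,
`a + b = n`. If `u₀` is majorized by `A / (1 - z/R)`, then `w_n` is majorized by the coefficient of
the exact solution for that majorant, `A^{n+1} R^{-n} Cat_n (1 - z/R)^{-(2n+1)}`
(`majorized_timeCoeff`); Catalan numbers grow geometrically, so the series converges for small `t` in
every ball of radius `ρ < ρ₀` (`exists_isSolution`).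
-/

noncomputable section

namespace Burgers

/-! ### The `L²` norm on the line -/

lemma L2Norm_nonneg (f : ℝ → ℝ) : 0 ≤ L2Norm f := ENNReal.toReal_nonneg

lemma L2Norm_add_le {f g : ℝ → ℝ} (hf : MemLp f 2 volume) (hg : MemLp g 2 volume) :
    L2Norm (fun x => f x + g x) ≤ L2Norm f + L2Norm g := by
  unfold L2Norm
  rw [← ENNReal.toReal_add hf.eLpNorm_ne_top hg.eLpNorm_ne_top]
  exact ENNReal.toReal_mono (ENNReal.add_ne_top.2 ⟨hf.eLpNorm_ne_top, hg.eLpNorm_ne_top⟩)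
    (eLpNorm_add_le hf.1 hg.1 (by norm_num))

lemma L2Norm_const_mul (c : ℝ) (f : ℝ → ℝ) : L2Norm (fun x => c * f x) = |c| * L2Norm f := by
  have := eLpNorm_const_smul c f 2 (volume : Measure ℝ)
  unfold L2Norm
  rw [show (fun x => c * f x) = c • f from rfl, this]
  simp

lemma L2Norm_sum_le {ι : Type*} (s : Finset ι) {f : ι → ℝ → ℝ}
    (hf : ∀ i ∈ s, MemLp (f i) 2 volume) :
    L2Norm (fun x => ∑ i ∈ s, f i x) ≤ ∑ i ∈ s, L2Norm (f i) := by
  classical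
  induction s using Finset.induction_on with
  | empty => simp [L2Norm]
  | insert a s ha ih =>
    simp only [Finset.sum_insert ha]
    refine (L2Norm_add_le (hf a (by simp))
      (memLp_finsetSum s fun i hi => hf i (by simp [hi]))).trans ?_
    gcongr
    exact ih fun i hi => hf i (by simp [hi])

lemma memLp_mul_of_bound {f g : ℝ → ℝ} {K : ℝ} (hfm : Continuous f) (hf : ∀ x, |f x| ≤ K)
    (hg : MemLp g 2 volume) : MemLp (fun x => f x * g x) 2 volume := by
  refine MemLp.of_le_mul (c := K) hg (hfm.aestronglyMeasurable.mul hg.1)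
    (Eventually.of_forall fun x => ?_)
  rw [norm_mul]
  exact mul_le_mul_of_nonneg_right (hf x) (norm_nonneg _)

lemma L2Norm_mul_le {f g : ℝ → ℝ} {K : ℝ} (hf : ∀ x, |f x| ≤ K)
    (hg : MemLp g 2 volume) : L2Norm (fun x => f x * g x) ≤ K * L2Norm g := by
  have hK : 0 ≤ K := (abs_nonneg _).trans (hf 0)
  have h := eLpNorm_le_mul_eLpNorm_of_ae_le_mul (f := fun x => f x * g x) (g := g) (c := K)
    (μ := volume)
    (Eventually.of_forall fun x => by
      rw [norm_mul]; exact mul_le_mul_of_nonneg_right (hf x) (norm_nonneg _)) 2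
  have h2 := ENNReal.toReal_mono (ENNReal.mul_ne_top ENNReal.ofReal_ne_top hg.eLpNorm_ne_top) h
  rwa [ENNReal.toReal_mul, ENNReal.toReal_ofReal hK] at h2

lemma inner_toLp {f g : ℝ → ℝ} (hf : MemLp f 2 volume) (hg : MemLp g 2 volume) :
    inner ℝ (hf.toLp f) (hg.toLp g) = ∫ x, f x * g x := by
  rw [L2.inner_def]
  refine integral_congr_ae ?_
  filter_upwards [hf.coeFn_toLp, hg.coeFn_toLp] with x h1 h2
  rw [h1, h2]
  simp [mul_comm]

lemma norm_toLp_eq {f : ℝ → ℝ} (hf : MemLp f 2 volume) : ‖hf.toLp f‖ = L2Norm f :=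
  Lp.norm_toLp f hf

lemma abs_integral_mul_le {f g : ℝ → ℝ} (hf : MemLp f 2 volume) (hg : MemLp g 2 volume) :
    |∫ x, f x * g x| ≤ L2Norm f * L2Norm g := by
  rw [← inner_toLp hf hg, ← norm_toLp_eq hf, ← norm_toLp_eq hg]
  exact abs_real_inner_le_norm _ _

lemma integrable_mul {f g : ℝ → ℝ} (hf : MemLp f 2 volume) (hg : MemLp g 2 volume) :
    Integrable (fun x => f x * g x) volume := MemLp.integrable_mul hf hg

lemma L2Norm_abs (f : ℝ → ℝ) : L2Norm (fun x => |f x|) = L2Norm f := by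
  unfold L2Norm
  rw [show (fun x => |f x|) = fun x => ‖f x‖ from rfl, eLpNorm_norm]

/-- The one-dimensional Sobolev (Agmon) inequality. -/
lemma sq_le_of_hasDerivAt {f f' : ℝ → ℝ} (h : ∀ x, HasDerivAt f (f' x) x)
    (hf : MemLp f 2 volume) (hf' : MemLp f' 2 volume) (x : ℝ) :
    f x ^ 2 ≤ 2 * (L2Norm f * L2Norm f') := by
  have hd : ∀ y, HasDerivAt (fun y => f y * f y) (f' y * f y + f y * f' y) y :=
    fun y => (h y).mul (h y)
  have hi : Integrable (fun y => f' y * f y + f y * f' y) :=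
    (integrable_mul hf' hf).add (integrable_mul hf hf')
  have ht : Tendsto (fun y => f y * f y) atBot (𝓝 0) :=
    tendsto_zero_of_hasDerivAt_of_integrableOn_Iic (a := 0) (fun y _ => hd y)
      hi.integrableOn (integrable_mul hf hf).integrableOn
  have h1 := integral_Iic_of_hasDerivAt_of_tendsto' (a := x) (fun y _ => hd y) hi.integrableOn ht
  rw [sub_zero] at h1
  have h2 : ∫ y in Iic x, (f' y * f y + f y * f' y) ≤ ∫ y, 2 * (|f y| * |f' y|) := by
    have hg : Integrable (fun y => 2 * (|f y| * |f' y|)) :=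
      (integrable_mul hf.abs hf'.abs).const_mul 2
    calc _ ≤ ∫ y in Iic x, 2 * (|f y| * |f' y|) := by
          refine integral_mono hi.integrableOn hg.integrableOn fun y => ?_
          have := le_abs_self (f y * f' y)
          rw [abs_mul] at this
          simp only
          linarith
      _ ≤ _ := setIntegral_le_integral hg (Eventually.of_forall fun y => by positivity)
  have h3 : ∫ y, |f y| * |f' y| ≤ L2Norm f * L2Norm f' := by
    have := abs_integral_mul_le hf.abs hf'.abs
    rw [show L2Norm |f| = L2Norm f from L2Norm_abs f,
      show L2Norm |f'| = L2Norm f' from L2Norm_abs f'] at this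
    exact (le_abs_self _).trans this
  rw [integral_const_mul] at h2
  nlinarith

lemma abs_le_of_hasDerivAt {f f' : ℝ → ℝ} (h : ∀ x, HasDerivAt f (f' x) x)
    (hf : MemLp f 2 volume) (hf' : MemLp f' 2 volume) (x : ℝ) :
    |f x| ≤ L2Norm f + L2Norm f' := by
  have h1 := sq_le_of_hasDerivAt h hf hf' x
  have a := L2Norm_nonneg f
  have b := L2Norm_nonneg f'
  refine abs_le_of_sq_le_sq ?_ (by positivity)
  nlinarith [sq_nonneg (L2Norm f), sq_nonneg (L2Norm f')]

/-- Transport terms lose no derivative: `∫ g (f g') = - ½ ∫ f' g²`. -/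
lemma abs_integral_transport_le {f f' g g' : ℝ → ℝ} (hf : ∀ x, HasDerivAt f (f' x) x)
    (hg : ∀ x, HasDerivAt g (g' x) x) {K K' : ℝ} (hK : ∀ x, |f x| ≤ K) (hK' : ∀ x, |f' x| ≤ K')
    (hf'c : Continuous f') (hgm : MemLp g 2 volume) (hgm' : MemLp g' 2 volume) :
    2 * |∫ x, g x * (f x * g' x)| ≤ K' * L2Norm g ^ 2 := by
  have hfc : Continuous f := continuous_iff_continuousAt.2 fun x => (hf x).continuousAt
  have hd : ∀ x, HasDerivAt (fun x => f x * (g x * g x))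
      (f' x * (g x * g x) + f x * (g' x * g x + g x * g' x)) x :=
    fun x => (hf x).mul ((hg x).mul (hg x))
  have m1 := memLp_mul_of_bound hf'c hK' hgm
  have m2 := memLp_mul_of_bound hfc hK hgm'
  have m3 := memLp_mul_of_bound hfc hK hgm
  have i1 : Integrable (fun x => (f' x * g x) * g x) := integrable_mul m1 hgm
  have i2 : Integrable (fun x => g x * (f x * g' x)) := integrable_mul hgm m2
  have i3 : Integrable (fun x => (f x * g x) * g x) := integrable_mul m3 hgm
  have hz : ∫ x, ((f' x * g x) * g x + 2 * (g x * (f x * g' x))) = 0 := by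
    have := integral_eq_zero_of_hasDerivAt_of_integrable hd
      ((i1.add (i2.const_mul 2)).congr (Eventually.of_forall fun x => by simp; ring))
      (i3.congr (Eventually.of_forall fun x => by simp; ring))
    rw [← this]
    congr 1; ext x; ring
  rw [integral_add i1 (i2.const_mul 2), integral_const_mul] at hz
  have e : 2 * |∫ x, g x * (f x * g' x)| = |∫ x, (f' x * g x) * g x| := by
    rw [← abs_two, ← abs_mul, ← abs_neg]
    congr 1
    linarith
  rw [e]
  calc _ ≤ L2Norm (fun x => f' x * g x) * L2Norm g := abs_integral_mul_le m1 hgm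
    _ ≤ K' * L2Norm g * L2Norm g := by
        gcongr
        · exact L2Norm_nonneg g
        · exact L2Norm_mul_le hK' hgm
    _ = _ := by ring

/-- Minkowski's inequality for pointwise convergent series. -/
lemma L2Norm_tsum_le {f : ℕ → ℝ → ℝ} {g : ℝ → ℝ} (hf : ∀ n, MemLp (f n) 2 volume)
    (hs : Summable fun n => L2Norm (f n)) (hg : ∀ x, HasSum (fun n => f n x) (g x)) :
    MemLp g 2 volume ∧ L2Norm g ≤ ∑' n, L2Norm (f n) := by
  have hm : ∀ N : ℕ, MemLp (fun x => ∑ n ∈ Finset.range N, f n x) 2 volume :=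
    fun N => memLp_finsetSum _ fun i _ => hf i
  have ht : ∀ᵐ x : ℝ, Tendsto (fun N : ℕ => ∑ n ∈ Finset.range N, f n x) atTop (𝓝 (g x)) :=
    Eventually.of_forall fun x => (hg x).tendsto_sum_nat
  have h0 : 0 ≤ ∑' n, L2Norm (f n) := tsum_nonneg fun n => L2Norm_nonneg _
  have hb : eLpNorm g 2 volume ≤ ENNReal.ofReal (∑' n, L2Norm (f n)) := by
    refine Lp.eLpNorm_le_of_ae_tendsto (u := atTop)
      (f := fun N : ℕ => fun x => ∑ n ∈ Finset.range N, f n x)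
      (Eventually.of_forall fun N => ?_) (fun N => (hm N).1) ht
    rw [← ENNReal.ofReal_toReal (hm N).eLpNorm_ne_top]
    exact ENNReal.ofReal_le_ofReal ((L2Norm_sum_le _ fun i _ => hf i).trans
      (hs.sum_le_tsum _ fun i _ => L2Norm_nonneg _))
  refine ⟨⟨aestronglyMeasurable_of_tendsto_ae _ (fun N => (hm N).1) ht,
    hb.trans_lt ENNReal.ofReal_lt_top⟩, ?_⟩
  have := ENNReal.toReal_mono ENNReal.ofReal_ne_top hb
  rwa [ENNReal.toReal_ofReal h0] at this

/-! ### Smooth square integrable functions and the spaces `B_{α,ρ}` -/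

/-- The space `H^∞(ℝ)`: smooth functions all of whose derivatives are square integrable. -/
structure IsHInf (f : ℝ → ℝ) : Prop where
  smooth : ContDiff ℝ (⊤ : ℕ∞) f
  memLp : ∀ n : ℕ, MemLp (iteratedDeriv n f) 2 volume

lemma MemB.isHInf {α ρ : ℝ} {f : ℝ → ℝ} (h : MemB α ρ f) : IsHInf f := ⟨h.smooth, h.memLp⟩

lemma derivNorm_nonneg (n : ℕ) (f : ℝ → ℝ) : 0 ≤ derivNorm n f := L2Norm_nonneg _

namespace IsHInf

variable {f g : ℝ → ℝ}

lemma contDiffAt (hf : IsHInf f) (n : ℕ) (x : ℝ) : ContDiffAt ℝ n f x :=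
  (hf.smooth.of_le (by exact_mod_cast le_top)).contDiffAt

lemma hasDerivAt (hf : IsHInf f) (n : ℕ) (x : ℝ) :
    HasDerivAt (iteratedDeriv n f) (iteratedDeriv (n + 1) f x) x := by
  rw [iteratedDeriv_succ]
  exact ((hf.smooth.differentiable_iteratedDeriv n (by exact_mod_cast ENat.natCast_lt_top n)) x).hasDerivAt

lemma continuous (hf : IsHInf f) (n : ℕ) : Continuous (iteratedDeriv n f) :=
  hf.smooth.continuous_iteratedDeriv n (by exact_mod_cast le_top)

lemma abs_le (hf : IsHInf f) (n : ℕ) (x : ℝ) :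
    |iteratedDeriv n f x| ≤ derivNorm n f + derivNorm (n + 1) f :=
  abs_le_of_hasDerivAt (hf.hasDerivAt n) (hf.memLp n) (hf.memLp (n + 1)) x

lemma iteratedDeriv_add (hf : IsHInf f) (hg : IsHInf g) (n : ℕ) :
    iteratedDeriv n (fun x => f x + g x) = fun x => iteratedDeriv n f x + iteratedDeriv n g x := by
  ext x
  exact _root_.iteratedDeriv_add (hf.contDiffAt n x) (hg.contDiffAt n x)

lemma iteratedDeriv_const_mul (c : ℝ) (f : ℝ → ℝ) (n : ℕ) :
    iteratedDeriv n (fun x => c * f x) = fun x => c * iteratedDeriv n f x := by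
  ext x
  simp

lemma add (hf : IsHInf f) (hg : IsHInf g) : IsHInf (fun x => f x + g x) :=
  ⟨hf.smooth.add hg.smooth, fun n => by
    rw [hf.iteratedDeriv_add hg]; exact (hf.memLp n).add (hg.memLp n)⟩

lemma const_mul (c : ℝ) (hf : IsHInf f) : IsHInf (fun x => c * f x) :=
  ⟨contDiff_const.mul hf.smooth, fun n => by
    rw [iteratedDeriv_const_mul]; exact (hf.memLp n).const_mul c⟩

lemma derivNorm_add_le (hf : IsHInf f) (hg : IsHInf g) (n : ℕ) :
    derivNorm n (fun x => f x + g x) ≤ derivNorm n f + derivNorm n g := by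
  unfold derivNorm
  rw [hf.iteratedDeriv_add hg]
  exact L2Norm_add_le (hf.memLp n) (hg.memLp n)

lemma derivNorm_const_mul (c : ℝ) (f : ℝ → ℝ) (n : ℕ) :
    derivNorm n (fun x => c * f x) = |c| * derivNorm n f := by
  unfold derivNorm
  rw [iteratedDeriv_const_mul, L2Norm_const_mul]

lemma neg (hf : IsHInf f) : IsHInf (fun x => -f x) := by
  simpa using hf.const_mul (-1)

lemma derivNorm_neg (f : ℝ → ℝ) (n : ℕ) : derivNorm n (fun x => -f x) = derivNorm n f := by
  simpa using derivNorm_const_mul (-1) f n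

lemma sub (hf : IsHInf f) (hg : IsHInf g) : IsHInf (fun x => f x - g x) := by
  simpa [sub_eq_add_neg] using hf.add hg.neg

lemma derivNorm_sub_le (hf : IsHInf f) (hg : IsHInf g) (n : ℕ) :
    derivNorm n (fun x => f x - g x) ≤ derivNorm n f + derivNorm n g := by
  have := hf.derivNorm_add_le hg.neg n
  rw [derivNorm_neg] at this
  simpa [sub_eq_add_neg] using this

lemma iteratedDeriv_sub (hf : IsHInf f) (hg : IsHInf g) (n : ℕ) :
    iteratedDeriv n (fun x => f x - g x) = fun x => iteratedDeriv n f x - iteratedDeriv n g x := by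
  ext x
  exact _root_.iteratedDeriv_sub (hf.contDiffAt n x) (hg.contDiffAt n x)

lemma iteratedDeriv_deriv (f : ℝ → ℝ) (n : ℕ) :
    iteratedDeriv n (deriv f) = iteratedDeriv (n + 1) f := iteratedDeriv_succ'.symm

lemma deriv (hf : IsHInf f) : IsHInf (deriv f) :=
  ⟨by
    have := contDiff_infty_iff_deriv.1 hf.smooth
    exact this.2,
   fun n => by rw [iteratedDeriv_deriv]; exact hf.memLp (n + 1)⟩

lemma derivNorm_deriv (f : ℝ → ℝ) (n : ℕ) :
    derivNorm n (_root_.deriv f) = derivNorm (n + 1) f := by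
  unfold derivNorm; rw [iteratedDeriv_deriv]

lemma iteratedDeriv_mul (hf : IsHInf f) (hg : IsHInf g) (n : ℕ) :
    iteratedDeriv n (fun x => f x * g x) = fun x => ∑ i ∈ Finset.range (n + 1),
      (n.choose i : ℝ) * (iteratedDeriv i f x * iteratedDeriv (n - i) g x) := by
  ext x
  have := _root_.iteratedDeriv_mul (hf.contDiffAt n x) (hg.contDiffAt n x)
  rw [show (fun x => f x * g x) = f * g from rfl, this]
  simp only [mul_assoc]

lemma memLp_mul (hf : IsHInf f) (hg : IsHInf g) (i j : ℕ) :
    MemLp (fun x => iteratedDeriv i f x * iteratedDeriv j g x) 2 volume :=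
  memLp_mul_of_bound (hf.continuous i) (hf.abs_le i) (hg.memLp j)

lemma mul (hf : IsHInf f) (hg : IsHInf g) : IsHInf (fun x => f x * g x) :=
  ⟨hf.smooth.mul hg.smooth, fun n => by
    rw [hf.iteratedDeriv_mul hg]
    exact memLp_finsetSum _ fun i _ => (hf.memLp_mul hg i (n - i)).const_mul _⟩

lemma zero : IsHInf (fun _ => (0 : ℝ)) :=
  ⟨contDiff_const, fun n => by
    rw [show iteratedDeriv n (fun _ : ℝ => (0 : ℝ)) = fun _ => 0 by ext x; simp]
    exact MemLp.zero'⟩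

lemma sum {ι : Type*} (s : Finset ι) {F : ι → ℝ → ℝ} (hF : ∀ i ∈ s, IsHInf (F i)) :
    IsHInf (fun x => ∑ i ∈ s, F i x) := by
  classical
  induction s using Finset.induction_on with
  | empty => simpa using zero
  | insert a s ha ih =>
    simp only [Finset.sum_insert ha]
    exact (hF a (by simp)).add (ih fun i hi => hF i (by simp [hi]))

lemma L2Norm_mul_iteratedDeriv_le (hf : IsHInf f) (hg : IsHInf g) (i j : ℕ) :
    L2Norm (fun x => iteratedDeriv i f x * iteratedDeriv j g x) ≤
      (derivNorm i f + derivNorm (i + 1) f) * derivNorm j g :=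
  L2Norm_mul_le (hf.abs_le i) (hg.memLp j)

end IsHInf

lemma one_le_weight {α : ℝ} (hα : 0 ≤ α) (n : ℕ) : 1 ≤ weight α n :=
  Real.one_le_rpow (by exact_mod_cast le_max_right n 1) hα

lemma weight_pos (α : ℝ) (n : ℕ) : 0 < weight α n :=
  Real.rpow_pos_of_pos (by exact_mod_cast lt_max_of_lt_right one_pos) α

lemma BTerm_nonneg (α : ℝ) {ρ : ℝ} (hρ : 0 ≤ ρ) (f : ℝ → ℝ) (n : ℕ) : 0 ≤ BTerm α ρ f n := by
  have := derivNorm_nonneg n f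
  have := (weight_pos α n).le
  unfold BTerm
  positivity

lemma BNorm_nonneg (α : ℝ) {ρ : ℝ} (hρ : 0 ≤ ρ) (f : ℝ → ℝ) : 0 ≤ BNorm α ρ f :=
  tsum_nonneg (BTerm_nonneg α hρ f)

lemma MemB.derivNorm_le {α ρ : ℝ} {f : ℝ → ℝ} (hρ : 0 < ρ) (h : MemB α ρ f) (n : ℕ) :
    derivNorm n f ≤ BNorm α ρ f * ((n.factorial : ℝ) / weight α n) * (1 / ρ ^ n) := by
  have h1 : BTerm α ρ f n ≤ BNorm α ρ f :=
    h.summable.le_tsum n fun m _ => BTerm_nonneg α hρ.le f m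
  have hw := weight_pos α n
  have hn : (0 : ℝ) < n.factorial := by exact_mod_cast n.factorial_pos
  have hp : 0 < ρ ^ n := by positivity
  have e : derivNorm n f = BTerm α ρ f n * ((n.factorial : ℝ) / weight α n) * (1 / ρ ^ n) := by
    unfold BTerm; field_simp
  rw [e]
  gcongr

lemma MemB.derivNorm_le_unweighted {α ρ : ℝ} (hα : 0 ≤ α) (hρ : 0 < ρ) {f : ℝ → ℝ}
    (h : MemB α ρ f) (n : ℕ) : derivNorm n f ≤ BNorm α ρ f * (n.factorial / ρ ^ n) := by
  have h0 := BNorm_nonneg α hρ.le f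
  refine (h.derivNorm_le hρ n).trans ?_
  have h2 : (n.factorial : ℝ) / weight α n ≤ n.factorial :=
    div_le_self (by positivity) (one_le_weight hα n)
  calc BNorm α ρ f * ((n.factorial : ℝ) / weight α n) * (1 / ρ ^ n)
      ≤ BNorm α ρ f * (n.factorial : ℝ) * (1 / ρ ^ n) := by gcongr
    _ = _ := by ring

lemma MemB.of_isHInf {α ρ : ℝ} {f : ℝ → ℝ} (hf : IsHInf f) (hρ : 0 ≤ ρ) {b : ℕ → ℝ}
    (hb : ∀ n, BTerm α ρ f n ≤ b n) (hs : Summable b) : MemB α ρ f :=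
  ⟨hf.smooth, hf.memLp, Summable.of_nonneg_of_le (BTerm_nonneg α hρ f) hb hs⟩

lemma BTerm_mono {α ρ : ℝ} (hρ : 0 ≤ ρ) {f : ℝ → ℝ} {n : ℕ} {K : ℝ} (h : derivNorm n f ≤ K) :
    BTerm α ρ f n ≤ K / (n.factorial : ℝ) * weight α n * ρ ^ n := by
  have := (weight_pos α n).le
  unfold BTerm
  gcongr

lemma MemB.sub {α ρ : ℝ} (hρ : 0 ≤ ρ) {f g : ℝ → ℝ} (hf : MemB α ρ f) (hg : MemB α ρ g) :
    MemB α ρ (fun x => f x - g x) := by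
  refine MemB.of_isHInf (hf.isHInf.sub hg.isHInf) hρ (fun n => ?_) (hf.summable.add hg.summable)
  refine (BTerm_mono hρ (hf.isHInf.derivNorm_sub_le hg.isHInf n)).trans_eq ?_
  unfold BTerm
  ring

lemma MemB.div_const {α ρ : ℝ} (hρ : 0 ≤ ρ) {f : ℝ → ℝ} (hf : MemB α ρ f) (c : ℝ) :
    MemB α ρ (fun x => f x / c) := by
  have e : (fun x => f x / c) = fun x => c⁻¹ * f x := by ext x; field_simp
  rw [e]
  refine MemB.of_isHInf (hf.isHInf.const_mul c⁻¹) hρ (fun n => ?_) (hf.summable.mul_left |c⁻¹|)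
  rw [BTerm, IsHInf.derivNorm_const_mul, BTerm]
  exact le_of_eq (by ring)

/-! ### Curves in `B_{α,ρ}` -/

open Classical in
/-- The class of `D^n f` in `L²(ℝ)`, with the junk value `0` when `D^n f` is not in `L²`. -/
def derivLp (n : ℕ) (f : ℝ → ℝ) : Lp ℝ 2 (volume : Measure ℝ) :=
  if h : MemLp (iteratedDeriv n f) 2 volume then h.toLp else 0

lemma IsHInf.derivLp_eq {f : ℝ → ℝ} (hf : IsHInf f) (n : ℕ) :
    derivLp n f = (hf.memLp n).toLp := dif_pos (hf.memLp n)

lemma IsHInf.norm_derivLp {f : ℝ → ℝ} (hf : IsHInf f) (n : ℕ) :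
    ‖derivLp n f‖ = derivNorm n f := by
  rw [hf.derivLp_eq, norm_toLp_eq, derivNorm]

lemma IsHInf.derivLp_sub {f g : ℝ → ℝ} (hf : IsHInf f) (hg : IsHInf g) (n : ℕ) :
    derivLp n (fun x => f x - g x) = derivLp n f - derivLp n g := by
  rw [hf.derivLp_eq, hg.derivLp_eq, (hf.sub hg).derivLp_eq, ← MemLp.toLp_sub]
  congr 1
  exact hf.iteratedDeriv_sub hg n

lemma IsHInf.derivLp_const_mul {f : ℝ → ℝ} (hf : IsHInf f) (c : ℝ) (n : ℕ) :
    derivLp n (fun x => c * f x) = c • derivLp n f := by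
  rw [hf.derivLp_eq, (hf.const_mul c).derivLp_eq, ← MemLp.toLp_const_smul]
  congr 1
  exact IsHInf.iteratedDeriv_const_mul c f n

lemma IsHInf.derivLp_div_const {f : ℝ → ℝ} (hf : IsHInf f) (c : ℝ) (n : ℕ) :
    derivLp n (fun x => f x / c) = c⁻¹ • derivLp n f := by
  rw [← hf.derivLp_const_mul]
  congr 1
  ext x
  ring

lemma IsHInf.div_const {f : ℝ → ℝ} (hf : IsHInf f) (c : ℝ) : IsHInf (fun x => f x / c) := by
  simpa [div_eq_inv_mul] using hf.const_mul c⁻¹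

lemma tendsto_derivNorm_of_BNorm {α ρ : ℝ} (hρ : 0 < ρ) {l : Filter ℝ} {F : ℝ → ℝ → ℝ}
    (hF : ∀ᶠ s in l, MemB α ρ (F s)) (h : Tendsto (fun s => BNorm α ρ (F s)) l (𝓝 0)) (n : ℕ) :
    Tendsto (fun s => derivNorm n (F s)) l (𝓝 0) := by
  have h2 := (h.mul_const ((n.factorial : ℝ) / weight α n)).mul_const (1 / ρ ^ n)
  simp only [zero_mul] at h2
  refine tendsto_of_tendsto_of_tendsto_of_le_of_le' tendsto_const_nhds h2
    (Eventually.of_forall fun s => derivNorm_nonneg n _) ?_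
  filter_upwards [hF] with s hs using hs.derivNorm_le hρ n

/-- Convergence of each derivative in `L²` together with a summable majorant gives convergence in
`B_{α,r}`. -/
lemma tendsto_BNorm_of_derivNorm {α r : ℝ} (hr : 0 ≤ r) {l : Filter ℝ} {F : ℝ → ℝ → ℝ}
    {b : ℕ → ℝ} (hb : ∀ᶠ s in l, ∀ n, derivNorm n (F s) ≤ b n)
    (hs : Summable fun n => b n / (n.factorial : ℝ) * weight α n * r ^ n)
    (h : ∀ n, Tendsto (fun s => derivNorm n (F s)) l (𝓝 0)) :
    Tendsto (fun s => BNorm α r (F s)) l (𝓝 0) := by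
  have h2 := tendsto_tsum_of_dominated_convergence (𝓕 := l) (f := fun s n => BTerm α r (F s) n)
    (g := fun _ => 0) hs (fun n => by
      have := (((h n).div_const (n.factorial : ℝ)).mul_const (weight α n)).mul_const (r ^ n)
      simpa [BTerm] using this)
    (by
      filter_upwards [hb] with s hs n
      rw [Real.norm_of_nonneg (BTerm_nonneg α hr _ n)]
      exact BTerm_mono hr (hs n))
  simpa [BNorm] using h2

namespace IsC1Curve

variable {α ρ T : ℝ} {u v : ℝ → ℝ → ℝ}

lemma restrict (h : IsC1Curve α ρ T u v) {T' : ℝ} (hT : T' ≤ T) : IsC1Curve α ρ T' u v := by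
  have hs : Icc 0 T' ⊆ Icc 0 T := Icc_subset_Icc_right hT
  exact ⟨fun t ht => h.mem t (hs ht), fun t ht => h.mem_deriv t (hs ht),
    fun t ht => (h.hasDeriv t (hs ht)).mono_left (nhdsWithin_mono _ (sdiff_subset_sdiff_left hs)),
    fun t ht => (h.continuous_deriv t (hs ht)).mono_left (nhdsWithin_mono _ hs)⟩

lemma memB_quotient (h : IsC1Curve α ρ T u v) (hρ : 0 ≤ ρ) {s t : ℝ} (hs : s ∈ Icc 0 T)
    (ht : t ∈ Icc 0 T) : MemB α ρ (fun x => (u s x - u t x) / (s - t) - v t x) :=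
  (((h.mem s hs).sub hρ (h.mem t ht)).div_const hρ _).sub hρ (h.mem_deriv t ht)

lemma tendsto_derivNorm_quotient (h : IsC1Curve α ρ T u v) (hρ : 0 < ρ) {t : ℝ}
    (ht : t ∈ Icc 0 T) (n : ℕ) :
    Tendsto (fun s => derivNorm n (fun x => (u s x - u t x) / (s - t) - v t x))
      (𝓝[Icc 0 T \ {t}] t) (𝓝 0) :=
  tendsto_derivNorm_of_BNorm hρ
    (eventually_mem_nhdsWithin.mono fun _ hs => h.memB_quotient hρ.le hs.1 ht) (h.hasDeriv t ht) n

/-- A `C¹` curve in `B_{α,ρ}` gives, for each `n`, a differentiable curve `t ↦ D^n u(t)` in the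
Hilbert space `L²(ℝ)`. -/
lemma hasDerivWithinAt_derivLp (h : IsC1Curve α ρ T u v) (hρ : 0 < ρ) {t : ℝ}
    (ht : t ∈ Icc 0 T) (n : ℕ) :
    HasDerivWithinAt (fun s => derivLp n (u s)) (derivLp n (v t)) (Icc 0 T) t := by
  rw [hasDerivWithinAt_iff_tendsto_slope, tendsto_iff_norm_sub_tendsto_zero]
  refine (h.tendsto_derivNorm_quotient hρ ht n).congr' ?_
  filter_upwards [eventually_mem_nhdsWithin] with s hs
  have h1 := (h.mem s hs.1).isHInf
  have h2 := (h.mem t ht).isHInf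
  have h3 := (h.mem_deriv t ht).isHInf
  rw [← (h.memB_quotient hρ.le hs.1 ht).isHInf.norm_derivLp,
    ((h1.sub h2).div_const _).derivLp_sub h3, (h1.sub h2).derivLp_div_const, h1.derivLp_sub h2]
  rfl

lemma hasDerivWithinAt_derivNorm_sq (h : IsC1Curve α ρ T u v) (hρ : 0 < ρ) {t : ℝ}
    (ht : t ∈ Icc 0 T) (n : ℕ) :
    HasDerivWithinAt (fun s => derivNorm n (u s) ^ 2)
      (2 * ∫ x, iteratedDeriv n (u t) x * iteratedDeriv n (v t) x) (Icc 0 T) t := by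
  have h1 := (h.hasDerivWithinAt_derivLp hρ ht n).norm_sq
  rw [(h.mem t ht).isHInf.derivLp_eq, (h.mem_deriv t ht).isHInf.derivLp_eq, inner_toLp] at h1
  exact h1.congr (fun s hs => by rw [(h.mem s hs).isHInf.norm_derivLp])
    (by rw [(h.mem t ht).isHInf.norm_derivLp])

lemma derivNorm_quotient_le (h : IsC1Curve α ρ T u v) (hρ : 0 < ρ) {s t : ℝ}
    (hs : s ∈ Icc 0 T) (ht : t ∈ Icc 0 T) (hst : s ≠ t) (n : ℕ) {K : ℝ}
    (hK : ∀ τ ∈ Icc 0 T, derivNorm n (v τ) ≤ K) :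
    derivNorm n (fun x => (u s x - u t x) / (s - t)) ≤ K := by
  have h1 := (h.mem s hs).isHInf
  have h2 := (h.mem t ht).isHInf
  have := (convex_Icc 0 T).norm_image_sub_le_of_norm_hasDerivWithin_le (C := K)
    (fun τ hτ => h.hasDerivWithinAt_derivLp hρ hτ n)
    (fun τ hτ => by rw [(h.mem_deriv τ hτ).isHInf.norm_derivLp]; exact hK τ hτ) ht hs
  rw [← ((h1.sub h2).div_const _).norm_derivLp, (h1.sub h2).derivLp_div_const, h1.derivLp_sub h2,
    norm_smul, norm_inv]
  have hp : 0 < ‖s - t‖ := norm_pos_iff.2 (sub_ne_zero.2 hst)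
  rwa [inv_mul_le_iff₀ hp, mul_comm]

/-- Interpolation between radii: a `C¹` curve in some `B_{α,ρ}` whose values and velocities
obey uniform derivative bounds that are summable with radius `r` is a `C¹` curve in `B_{α,r}`. -/
lemma change_radius (h : IsC1Curve α ρ T u v) (hρ : 0 < ρ) {r : ℝ} (hr : 0 ≤ r) {U V : ℕ → ℝ}
    (hU : ∀ t ∈ Icc 0 T, ∀ n, derivNorm n (u t) ≤ U n)
    (hV : ∀ t ∈ Icc 0 T, ∀ n, derivNorm n (v t) ≤ V n)
    (sU : Summable fun n => U n / (n.factorial : ℝ) * weight α n * r ^ n)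
    (sV : Summable fun n => V n / (n.factorial : ℝ) * weight α n * r ^ n) :
    IsC1Curve α r T u v := by
  have s2 : Summable fun n => (V n + V n) / (n.factorial : ℝ) * weight α n * r ^ n := by
    convert! sV.add sV using 2 with n
    ring
  refine ⟨fun t ht => MemB.of_isHInf (h.mem t ht).isHInf hr
      (fun n => BTerm_mono hr (hU t ht n)) sU,
    fun t ht => MemB.of_isHInf (h.mem_deriv t ht).isHInf hr
      (fun n => BTerm_mono hr (hV t ht n)) sV, fun t ht => ?_, fun t ht => ?_⟩
  · refine tendsto_BNorm_of_derivNorm hr ?_ s2 fun n => h.tendsto_derivNorm_quotient hρ ht n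
    filter_upwards [eventually_mem_nhdsWithin] with s hs n
    refine ((((h.mem s hs.1).isHInf.sub (h.mem t ht).isHInf).div_const _).derivNorm_sub_le
      (h.mem_deriv t ht).isHInf n).trans (add_le_add ?_ (hV t ht n))
    exact h.derivNorm_quotient_le hρ hs.1 ht hs.2 n fun τ hτ => hV τ hτ n
  · refine tendsto_BNorm_of_derivNorm hr ?_ s2 fun n => tendsto_derivNorm_of_BNorm hρ
      (eventually_mem_nhdsWithin.mono fun s hs => (h.mem_deriv s hs).sub hρ.le (h.mem_deriv t ht))
      (h.continuous_deriv t ht) n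
    filter_upwards [eventually_mem_nhdsWithin] with s hs n
    exact ((h.mem_deriv s hs).isHInf.derivNorm_sub_le (h.mem_deriv t ht).isHInf n).trans
      (add_le_add (hV s hs n) (hV t ht n))

end IsC1Curve

/-! ### Energy inequalities -/

namespace IsHInf

variable {f : ℝ → ℝ}

lemma iteratedDeriv_burgers (hf : IsHInf f) (J : ℕ) (x : ℝ) :
    iteratedDeriv J (fun x => -(f x * _root_.deriv f x)) x =
      -(f x * iteratedDeriv (J + 1) f x) - ∑ i ∈ Finset.range J,
        (J.choose (i + 1) : ℝ) * (iteratedDeriv (i + 1) f x * iteratedDeriv (J - i) f x) := by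
  rw [iteratedDeriv_fun_neg, hf.iteratedDeriv_mul hf.deriv]
  beta_reduce
  rw [Finset.sum_range_succ']
  have : ∀ i ∈ Finset.range J, (J.choose (i + 1) : ℝ) *
      (iteratedDeriv (i + 1) f x * iteratedDeriv (J - (i + 1)) (_root_.deriv f) x) =
      (J.choose (i + 1) : ℝ) * (iteratedDeriv (i + 1) f x * iteratedDeriv (J - i) f x) := by
    intro i hi
    rw [iteratedDeriv_deriv, show J - (i + 1) + 1 = J - i by have := Finset.mem_range.1 hi; omega]
  rw [Finset.sum_congr rfl this, iteratedDeriv_deriv]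
  simp
  ring

/-- The energy inequality at level `J`: the term carrying `J + 1` derivatives is integrated by
parts, the remaining terms of the Leibniz formula are kept. -/
lemma energy_le (hf : IsHInf f) {m : ℝ} (hm : ∀ x, |_root_.deriv f x| ≤ m) (J : ℕ) :
    2 * ∫ x, iteratedDeriv J f x * iteratedDeriv J (fun x => -(f x * _root_.deriv f x)) x ≤
      m * derivNorm J f ^ 2 + 2 * derivNorm J f * ∑ i ∈ Finset.range J, (J.choose (i + 1) : ℝ) *
        L2Norm (fun x => iteratedDeriv (i + 1) f x * iteratedDeriv (J - i) f x) := by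
  set S : ℝ → ℝ := fun x => ∑ i ∈ Finset.range J,
    (J.choose (i + 1) : ℝ) * (iteratedDeriv (i + 1) f x * iteratedDeriv (J - i) f x) with hS
  have hSm : MemLp S 2 volume :=
    memLp_finsetSum _ fun i _ => (hf.memLp_mul hf (i + 1) (J - i)).const_mul _
  have hSn : L2Norm S ≤ ∑ i ∈ Finset.range J, (J.choose (i + 1) : ℝ) *
        L2Norm (fun x => iteratedDeriv (i + 1) f x * iteratedDeriv (J - i) f x) := by
    refine (L2Norm_sum_le _ fun i _ =>
      (hf.memLp_mul hf (i + 1) (J - i)).const_mul _).trans_eq ?_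
    refine Finset.sum_congr rfl fun i _ => ?_
    rw [L2Norm_const_mul, abs_of_nonneg (by positivity)]
  have hf0 : ∀ x, HasDerivAt f (_root_.deriv f x) x := fun x => by
    simpa using hf.hasDerivAt 0 x
  have hf0b : ∀ x, |f x| ≤ derivNorm 0 f + derivNorm 1 f := fun x => by
    simpa using hf.abs_le 0 x
  have hf1c : Continuous (_root_.deriv f) := by simpa using hf.continuous 1
  have htr := abs_integral_transport_le hf0 (hf.hasDerivAt J) hf0b hm hf1c (hf.memLp J)
    (hf.memLp (J + 1))
  have m2 : MemLp (fun x => f x * iteratedDeriv (J + 1) f x) 2 volume := by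
    simpa using hf.memLp_mul hf 0 (J + 1)
  have i1 := integrable_mul (hf.memLp J) m2
  have i2 := integrable_mul (hf.memLp J) hSm
  have e : ∫ x, iteratedDeriv J f x * iteratedDeriv J (fun x => -(f x * _root_.deriv f x)) x =
      -(∫ x, iteratedDeriv J f x * (f x * iteratedDeriv (J + 1) f x)) -
        ∫ x, iteratedDeriv J f x * S x := by
    have hs := integral_sub i1.neg i2
    simp only [Pi.neg_apply] at hs
    rw [← integral_neg, ← hs]
    congr 1
    ext x
    rw [hf.iteratedDeriv_burgers]
    simp only [hS]
    ring
  have h2 := abs_integral_mul_le (hf.memLp J) hSm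
  have h3 : L2Norm (iteratedDeriv J f) * L2Norm S ≤ derivNorm J f * _ :=
    mul_le_mul_of_nonneg_left hSn (derivNorm_nonneg J f)
  have h4 := neg_abs_le (∫ x, iteratedDeriv J f x * (f x * iteratedDeriv (J + 1) f x))
  have h5 := neg_abs_le (∫ x, iteratedDeriv J f x * S x)
  rw [e]
  change _ ≤ m * derivNorm J f ^ 2 at htr
  linarith

lemma L2Norm_deriv_mul_le (hf : IsHInf f) {m : ℝ} (hm : ∀ x, |_root_.deriv f x| ≤ m) (J : ℕ) :
    L2Norm (fun x => iteratedDeriv 1 f x * iteratedDeriv J f x) ≤ m * derivNorm J f :=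
  L2Norm_mul_le (by simpa using hm) (hf.memLp J)

lemma L2Norm_mul_deriv_le (hf : IsHInf f) {m : ℝ} (hm : ∀ x, |_root_.deriv f x| ≤ m) (J : ℕ) :
    L2Norm (fun x => iteratedDeriv J f x * iteratedDeriv 1 f x) ≤ m * derivNorm J f := by
  simpa [mul_comm] using hf.L2Norm_deriv_mul_le hm J

lemma energy_low (hf : IsHInf f) {m : ℝ} (hm : ∀ x, |_root_.deriv f x| ≤ m) {J : ℕ}
    (hJ : J ≤ 2) :
    2 * ∫ x, iteratedDeriv J f x * iteratedDeriv J (fun x => -(f x * _root_.deriv f x)) x ≤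
      7 * m * derivNorm J f ^ 2 := by
  have hm0 : 0 ≤ m := (abs_nonneg _).trans (hm 0)
  refine (hf.energy_le hm J).trans ?_
  have a0 := derivNorm_nonneg J f
  have h1 := hf.L2Norm_deriv_mul_le hm J
  have h2 := hf.L2Norm_mul_deriv_le hm J
  have h3 : 0 ≤ m * derivNorm J f ^ 2 := by positivity
  rw [iteratedDeriv_one] at h1 h2
  have h4 := mul_le_mul_of_nonneg_left h1 a0
  have h5 := mul_le_mul_of_nonneg_left h2 a0
  interval_cases J
  · simp; linarith
  · rw [iteratedDeriv_one] at h4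
    simp
    linarith
  · simp [Finset.sum_range_succ]
    linarith

end IsHInf

/-- The sequence `k / k ^ α` is almost reproduced by convolution over `k + l = J + 1`, `2 ≤ k, l`:
the convolution is at most `K` times the value at `J`. The index `i` stands for `k - 2`. -/
def ConvolutionBound (α K : ℝ) : Prop :=
  ∀ J : ℕ, 3 ≤ J → ∑ i ∈ Finset.range (J - 2), (((i + 2 : ℕ) : ℝ) / weight α (i + 2)) *
    (((J - 1 - i : ℕ) : ℝ) / weight α (J - 1 - i)) ≤ K * (J / weight α J)

/-- It is here that `α > 2` is needed: `∑ k ^ (1 - α)` has to converge, since one of the two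
factors is always at most `(J / 2) ^ (1 - α)`. -/
lemma exists_convolutionBound {α : ℝ} (hα : 2 < α) :
    ∃ K : ℝ, 0 < K ∧ ConvolutionBound α K := by
  set q : ℕ → ℝ := fun n => (n : ℝ) ^ (1 - α) with hq
  have hqs : Summable q := Real.summable_nat_rpow.2 (by linarith)
  have hq0 : ∀ n, 0 ≤ q n := fun n => by positivity
  have hw : ∀ n : ℕ, 1 ≤ n → (n : ℝ) / weight α n = q n := by
    intro n hn
    have : (0 : ℝ) < n := by exact_mod_cast hn
    simp only [hq, weight, max_eq_left hn]
    rw [Real.rpow_sub this, Real.rpow_one]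
  have hanti : ∀ {a b : ℝ}, 0 < a → a ≤ b → b ^ (1 - α) ≤ a ^ (1 - α) := fun ha hab =>
    Real.rpow_le_rpow_of_nonpos ha hab (by linarith)
  set Z := ∑' n, q n with hZ
  have hZ0 : 0 < Z := hqs.tsum_pos hq0 1 (by simp [hq])
  refine ⟨(1 / 2 : ℝ) ^ (1 - α) * (2 * Z), by positivity, fun J hJ => ?_⟩
  have hJ0 : (0 : ℝ) < J := by exact_mod_cast (by omega : 0 < J)
  rw [hw J (by omega)]
  have hterm : ∀ i ∈ Finset.range (J - 2), (((i + 2 : ℕ) : ℝ) / weight α (i + 2)) *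
      (((J - 1 - i : ℕ) : ℝ) / weight α (J - 1 - i)) ≤
      ((1 / 2 : ℝ) ^ (1 - α) * q J) * (q (i + 2) + q (J - 2 - 1 - i + 2)) := by
    intro i hi
    have hi := Finset.mem_range.1 hi
    rw [hw _ (by omega), hw _ (by omega), show J - 2 - 1 - i + 2 = J - 1 - i by omega]
    set k := i + 2
    set l := J - 1 - i
    have hkl : k + l = J + 1 := by omega
    have hk0 : (0 : ℝ) < k := by exact_mod_cast (by omega : 0 < k)
    have hl0 : (0 : ℝ) < l := by exact_mod_cast (by omega : 0 < l)
    have hkl' : (k : ℝ) + l = J + 1 := by exact_mod_cast hkl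
    have e : (1 / 2 : ℝ) ^ (1 - α) * q J = (1 / 2 * J : ℝ) ^ (1 - α) := by
      rw [Real.mul_rpow (by norm_num) hJ0.le]
    rw [e]
    rcases le_total (k : ℝ) l with h | h
    · have : q l ≤ (1 / 2 * J : ℝ) ^ (1 - α) := hanti (by positivity) (by linarith)
      nlinarith [hq0 k, hq0 l]
    · have : q k ≤ (1 / 2 * J : ℝ) ^ (1 - α) := hanti (by positivity) (by linarith)
      nlinarith [hq0 k, hq0 l]
  refine (Finset.sum_le_sum hterm).trans ?_
  rw [← Finset.mul_sum, Finset.sum_add_distrib,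
    Finset.sum_range_reflect (fun i => q (i + 2)) (J - 2)]
  have hsum : ∑ i ∈ Finset.range (J - 2), q (i + 2) ≤ Z := by
    have h1 : Summable fun i => q (i + 2) := (summable_nat_add_iff 2).2 hqs
    refine (h1.sum_le_tsum _ fun i _ => hq0 _).trans ?_
    have := hqs.sum_add_tsum_nat_add 2
    have h2 : 0 ≤ ∑ i ∈ Finset.range 2, q i := Finset.sum_nonneg fun i _ => hq0 i
    linarith
  have : 0 ≤ (1 / 2 : ℝ) ^ (1 - α) * q J := by have := hq0 J; positivity
  nlinarith

namespace IsHInf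

variable {f : ℝ → ℝ}

/-- One product `D^k f D^l f` of the Leibniz formula, with the lower derivative estimated in the
supremum norm. The factor `l` on the left is the one that `J! l = C(J,k) k! l!` supplies. -/
lemma L2Norm_mul_le_of_le (hf : IsHInf f) {α R A X : ℝ} (hα : 2 < α) (hR : 0 < R) (hA : 0 ≤ A)
    (hX : 1 ≤ X) {J : ℕ}
    (ha : ∀ j, 2 ≤ j → j ≤ J → derivNorm j f ≤
      A * X ^ (j - 2) * ((j.factorial : ℝ) / weight α j) * (1 / R ^ j))
    {k l : ℕ} (hk : 2 ≤ k) (hkl : k ≤ l) (hJ : k + l = J + 1) :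
    (l : ℝ) * L2Norm (fun x => iteratedDeriv k f x * iteratedDeriv l f x) ≤
      A ^ 2 * (1 + 2 / R) * X ^ (J - 2) * (1 / R ^ (J + 1)) *
        ((k.factorial : ℝ) * l.factorial) * ((k / weight α k) * (l / weight α l)) := by
  have hwk := weight_pos α k
  have hwl := weight_pos α l
  have hX0 : 0 < X := by linarith
  have hwm : weight α k ≤ weight α (k + 1) :=
    Real.rpow_le_rpow (by positivity) (by exact_mod_cast max_le_max (by omega) le_rfl) (by linarith)
  have hk1 : (1 : ℝ) ≤ k := by exact_mod_cast (by omega : 1 ≤ k)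
  have h1 : derivNorm k f + derivNorm (k + 1) f ≤
      A * X ^ (k - 1) * (k.factorial * (k / weight α k)) * (1 / R ^ k) * (1 + 2 / R) := by
    have e1 := ha k hk (by omega)
    have e2 := ha (k + 1) (by omega) (by omega)
    have b1 : A * X ^ (k - 2) * ((k.factorial : ℝ) / weight α k) * (1 / R ^ k) ≤
        A * X ^ (k - 1) * ((k.factorial : ℝ) / weight α k) * (1 / R ^ k) := by
      gcongr
      norm_num
    have b2 : A * X ^ (k + 1 - 2) * (((k + 1).factorial : ℝ) / weight α (k + 1)) *
        (1 / R ^ (k + 1)) ≤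
        A * X ^ (k - 1) * (((k + 1 : ℝ) * k.factorial) / weight α k) * (1 / R ^ (k + 1)) := by
      rw [show k + 1 - 2 = k - 1 by omega, Nat.factorial_succ]
      push_cast
      gcongr
    have e3 : A * X ^ (k - 1) * ((k.factorial : ℝ) / weight α k) * (1 / R ^ k) +
        A * X ^ (k - 1) * (((k + 1 : ℝ) * k.factorial) / weight α k) * (1 / R ^ (k + 1)) =
        (A * X ^ (k - 1) * ((k.factorial : ℝ) / weight α k) * (1 / R ^ k)) *
          (1 + (k + 1) / R) := by
      rw [pow_succ]
      field_simp
    have e4 : A * X ^ (k - 1) * (k.factorial * (k / weight α k)) * (1 / R ^ k) * (1 + 2 / R) =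
        (A * X ^ (k - 1) * ((k.factorial : ℝ) / weight α k) * (1 / R ^ k)) *
          (k * (1 + 2 / R)) := by ring
    have e5 : (1 + (k + 1) / R) ≤ k * (1 + 2 / R) := by
      have : (k + 1) / R ≤ (2 * k) / R := by gcongr; linarith
      calc _ ≤ k + (2 * k) / R := by linarith
        _ = _ := by ring
    rw [e4]
    refine (add_le_add (e1.trans b1) (e2.trans b2)).trans ?_
    rw [e3]
    gcongr
  have h2 := hf.L2Norm_mul_iteratedDeriv_le hf k l
  have h3 := ha l (by omega) (by omega)
  calc (l : ℝ) * L2Norm (fun x => iteratedDeriv k f x * iteratedDeriv l f x)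
      ≤ l * ((A * X ^ (k - 1) * (k.factorial * (k / weight α k)) * (1 / R ^ k) * (1 + 2 / R)) *
          (A * X ^ (l - 2) * ((l.factorial : ℝ) / weight α l) * (1 / R ^ l))) := by
        gcongr
        refine h2.trans ?_
        have := derivNorm_nonneg l f
        gcongr
    _ = A ^ 2 * (1 + 2 / R) * (X ^ (k - 1) * X ^ (l - 2)) * (1 / (R ^ k * R ^ l)) *
        ((k.factorial : ℝ) * l.factorial) * ((k / weight α k) * (l / weight α l)) := by
        field_simp
    _ = _ := by
        rw [← pow_add, ← pow_add, hJ, show k - 1 + (l - 2) = J - 2 by omega]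

lemma choose_mul_L2Norm_le (hf : IsHInf f) {α R A X : ℝ} (hα : 2 < α) (hR : 0 < R) (hA : 0 ≤ A)
    (hX : 1 ≤ X) {J : ℕ}
    (ha : ∀ j, 2 ≤ j → j ≤ J → derivNorm j f ≤
      A * X ^ (j - 2) * ((j.factorial : ℝ) / weight α j) * (1 / R ^ j))
    {k l : ℕ} (hk : 2 ≤ k) (hl : 2 ≤ l) (hJ : k + l = J + 1) :
    (J.choose k : ℝ) * L2Norm (fun x => iteratedDeriv k f x * iteratedDeriv l f x) ≤
      A ^ 2 * (1 + 2 / R) * X ^ (J - 2) * (1 / R ^ (J + 1)) *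
        J.factorial * ((k / weight α k) * (l / weight α l)) := by
  set N := L2Norm (fun x => iteratedDeriv k f x * iteratedDeriv l f x) with hN
  have hN0 : 0 ≤ N := L2Norm_nonneg _
  set Y := A ^ 2 * (1 + 2 / R) * X ^ (J - 2) * (1 / R ^ (J + 1)) with hY
  have key : (l : ℝ) * N ≤ Y * ((k.factorial : ℝ) * l.factorial) *
      ((k / weight α k) * (l / weight α l)) := by
    rcases le_total k l with h | h
    · exact hf.L2Norm_mul_le_of_le hα hR hA hX ha hk h hJ
    · have h1 := hf.L2Norm_mul_le_of_le hα hR hA hX ha hl h (by omega : l + k = J + 1)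
      have h2 : L2Norm (fun x => iteratedDeriv l f x * iteratedDeriv k f x) = N := by
        simp only [hN, mul_comm]
      rw [h2] at h1
      calc (l : ℝ) * N ≤ k * N := by gcongr
        _ ≤ _ := h1
        _ = _ := by ring
  have hc : (J.choose k : ℝ) * (k.factorial * l.factorial) = J.factorial * l := by
    have h1 := Nat.choose_mul_factorial_mul_factorial (show k ≤ J by omega)
    have h2 : l.factorial = l * (J - k).factorial := by
      rw [show l = (J - k) + 1 by omega, Nat.factorial_succ]
    rw [← h1, h2]
    push_cast
    ring
  have hl0 : (0 : ℝ) < l := by exact_mod_cast (by omega : 0 < l)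
  refine le_of_mul_le_mul_left ?_ hl0
  calc (l : ℝ) * (J.choose k * N) = J.choose k * (l * N) := by ring
    _ ≤ J.choose k * (Y * ((k.factorial : ℝ) * l.factorial) *
      ((k / weight α k) * (l / weight α l))) := by gcongr
    _ = Y * (J.choose k * (k.factorial * l.factorial)) *
      ((k / weight α k) * (l / weight α l)) := by ring
    _ = _ := by rw [hc]; ring

/-- The energy inequality at level `J ≥ 3` under the analytic derivative bounds up to level `J`:
the quadratic terms cost a factor `J` only. -/
lemma energy_high (hf : IsHInf f) {α R A X K m : ℝ} (hα : 2 < α) (hR : 0 < R) (hA : 0 ≤ A)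
    (hX : 1 ≤ X)
    (hK : ConvolutionBound α K)
    (hm : ∀ x, |_root_.deriv f x| ≤ m) {J : ℕ} (hJ : 3 ≤ J)
    (ha : ∀ j, 2 ≤ j → j ≤ J → derivNorm j f ≤
      A * X ^ (j - 2) * ((j.factorial : ℝ) / weight α j) * (1 / R ^ j)) :
    2 * ∫ x, iteratedDeriv J f x * iteratedDeriv J (fun x => -(f x * _root_.deriv f x)) x ≤
      m * derivNorm J f ^ 2 + 2 * derivNorm J f * ((J + 1) * m * derivNorm J f +
        A * (K * (1 + 2 / R) / R) * J *
          (A * X ^ (J - 2) * ((J.factorial : ℝ) / weight α J) * (1 / R ^ J))) := by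
  refine (hf.energy_le hm J).trans ?_
  have a0 := derivNorm_nonneg J f
  gcongr
  obtain ⟨n, rfl⟩ : ∃ n, J = n + 2 := ⟨J - 2, by omega⟩
  rw [Finset.sum_range_succ, Finset.sum_range_succ']
  have hX0 : 0 < X := by linarith
  have b1 : ((n + 2).choose (0 + 1) : ℝ) * L2Norm
      (fun x => iteratedDeriv (0 + 1) f x * iteratedDeriv (n + 2 - 0) f x) ≤
      (n + 2) * (m * derivNorm (n + 2) f) := by
    have := hf.L2Norm_deriv_mul_le hm (n + 2)
    simp only [zero_add, Nat.choose_one_right, Nat.sub_zero]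
    push_cast
    gcongr
  have b2 : ((n + 2).choose (n + 1 + 1) : ℝ) * L2Norm
      (fun x => iteratedDeriv (n + 1 + 1) f x * iteratedDeriv (n + 2 - (n + 1)) f x) ≤
      m * derivNorm (n + 2) f := by
    have := hf.L2Norm_mul_deriv_le hm (n + 2)
    rw [show n + 2 - (n + 1) = 1 by omega]
    simpa using this
  have b3 : ∑ k ∈ Finset.range n, ((n + 2).choose (k + 1 + 1) : ℝ) * L2Norm
      (fun x => iteratedDeriv (k + 1 + 1) f x * iteratedDeriv (n + 2 - (k + 1)) f x) ≤
      A * (K * (1 + 2 / R) / R) * (n + 2) *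
        (A * X ^ n * (((n + 2).factorial : ℝ) / weight α (n + 2)) * (1 / R ^ (n + 2))) := by
    calc _ ≤ ∑ k ∈ Finset.range n, A ^ 2 * (1 + 2 / R) * X ^ n * (1 / R ^ (n + 2 + 1)) *
        (n + 2).factorial * ((((k + 2 : ℕ) : ℝ) / weight α (k + 2)) *
          (((n + 2 - 1 - k : ℕ) : ℝ) / weight α (n + 2 - 1 - k))) := by
          refine Finset.sum_le_sum fun k hk => ?_
          have hk := Finset.mem_range.1 hk
          have := hf.choose_mul_L2Norm_le hα hR hA hX ha (k := k + 2) (l := n + 2 - 1 - k)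
            (by omega) (by omega) (by omega)
          rw [show n + 2 - (k + 1) = n + 2 - 1 - k by omega]
          exact this
      _ = A ^ 2 * (1 + 2 / R) * X ^ n * (1 / R ^ (n + 2 + 1)) *
        (n + 2).factorial * ∑ k ∈ Finset.range n, ((((k + 2 : ℕ) : ℝ) / weight α (k + 2)) *
          (((n + 2 - 1 - k : ℕ) : ℝ) / weight α (n + 2 - 1 - k))) := by rw [Finset.mul_sum]
      _ ≤ A ^ 2 * (1 + 2 / R) * X ^ n * (1 / R ^ (n + 2 + 1)) *
        (n + 2).factorial * (K * ((n + 2 : ℕ) / weight α (n + 2))) := by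
          gcongr
          exact hK (n + 2) hJ
      _ = _ := by
          have := (weight_pos α (n + 2)).ne'
          push_cast
          field_simp
          ring
  rw [show n + 2 - 2 = n from rfl]
  push_cast at b1 b2 b3 ⊢
  linarith

end IsHInf

/-! ### Geometric derivative bounds and analyticity -/

lemma summable_pow_mul_weight_mul_geometric (α : ℝ) (k : ℕ) {x : ℝ} (hx0 : 0 < x) (hx1 : x < 1) :
    Summable fun n : ℕ => ((n : ℝ) + 1) ^ k * weight α n * x ^ n := by
  set p := ⌈α⌉₊ + k with hp
  have h1 : Summable fun n : ℕ => ((n : ℝ) + 1) ^ p * x ^ n := by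
    have h2 := summable_pow_mul_geometric_of_norm_lt_one (R := ℝ) p
      (by rwa [Real.norm_of_nonneg hx0.le])
    have h3 := ((summable_nat_add_iff 1).2 h2).mul_left x⁻¹
    refine h3.congr fun n => ?_
    push_cast
    rw [pow_succ x n]
    field_simp
  refine Summable.of_nonneg_of_le (fun n => ?_) (fun n => ?_) h1
  · have := weight_pos α n
    positivity
  · have hw : weight α n ≤ ((n : ℝ) + 1) ^ ⌈α⌉₊ := by
      have h1 : (1 : ℝ) ≤ ((max n 1 : ℕ) : ℝ) := by exact_mod_cast le_max_right n 1
      calc weight α n ≤ ((max n 1 : ℕ) : ℝ) ^ ((⌈α⌉₊ : ℕ) : ℝ) :=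
            Real.rpow_le_rpow_of_exponent_le h1 (Nat.le_ceil α)
        _ = ((max n 1 : ℕ) : ℝ) ^ ⌈α⌉₊ := Real.rpow_natCast _ _
        _ ≤ _ := by
          gcongr
          exact_mod_cast max_le (by omega : n ≤ n + 1) (by omega)
    calc _ ≤ ((n : ℝ) + 1) ^ k * ((n : ℝ) + 1) ^ ⌈α⌉₊ * x ^ n := by gcongr
      _ = _ := by rw [hp, pow_add]; ring

/-- The Taylor series of a smooth function whose derivatives grow like `n! / R ^ n` converges to
the function. -/
lemma hasSum_taylor {f : ℝ → ℝ} (hf : ContDiff ℝ (⊤ : ℕ∞) f) {C R : ℝ} (hR : 0 < R)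
    (hb : ∀ (n : ℕ) (x : ℝ), |iteratedDeriv n f x| ≤ C * (n + 1) * (n.factorial / R ^ n))
    (x : ℝ) {y : ℝ} (hy : |y| < R) :
    HasSum (fun n : ℕ => iteratedDeriv n f x / n.factorial * y ^ n) (f (x + y)) := by
  have hC : 0 ≤ C := by simpa using (abs_nonneg _).trans (hb 0 0)
  have hfn : ∀ n : ℕ, ContDiff ℝ n f := fun n => hf.of_le (by exact_mod_cast le_top)
  have hq0 : 0 ≤ |y| / R := by positivity
  have hq1 : |y| / R < 1 := (div_lt_one hR).2 hy
  have hsum : Summable fun n : ℕ => C * (((n : ℝ) + 1) * (|y| / R) ^ n) := by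
    refine Summable.mul_left C ?_
    have h1 := summable_pow_mul_geometric_of_norm_lt_one (R := ℝ) 1
      (by rwa [Real.norm_of_nonneg hq0])
    have h2 := summable_geometric_of_lt_one hq0 hq1
    refine (h1.add h2).congr fun n => ?_
    ring
  have hle : ∀ (n : ℕ) (z : ℝ), |iteratedDeriv n f z * y ^ n / n.factorial| ≤
      C * (((n : ℝ) + 1) * (|y| / R) ^ n) := by
    intro n z
    have hn : (0 : ℝ) < n.factorial := by exact_mod_cast n.factorial_pos
    rw [abs_div, abs_mul, abs_pow, Nat.abs_cast]
    calc _ ≤ C * (n + 1) * (n.factorial / R ^ n) * |y| ^ n / n.factorial := by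
          gcongr
          exact hb n z
      _ = _ := by rw [div_pow]; field_simp
  have hs : Summable fun n : ℕ => iteratedDeriv n f x / n.factorial * y ^ n := by
    refine Summable.of_norm_bounded hsum fun n => ?_
    rw [Real.norm_eq_abs, show iteratedDeriv n f x / n.factorial * y ^ n =
      iteratedDeriv n f x * y ^ n / n.factorial by ring]
    exact hle n x
  rcases eq_or_ne y 0 with rfl | hy0
  · convert! hasSum_single (f := fun n : ℕ => iteratedDeriv n f x / n.factorial * (0 : ℝ) ^ n) 0
      (fun n hn => by simp [hn]) using 1
    simp
  have hne : x ≠ x + y := by simpa using hy0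
  refine (hs.hasSum_iff_tendsto_nat).2 ?_
  rw [← tendsto_add_atTop_iff_nat 1]
  have hz : Tendsto (fun n : ℕ => C * (((n + 1 : ℕ) : ℝ) + 1) * (|y| / R) ^ (n + 1)) atTop (𝓝 0) := by
    have := (tendsto_add_atTop_iff_nat 1).2 hsum.tendsto_atTop_zero
    refine this.congr fun n => ?_
    ring
  rw [tendsto_iff_norm_sub_tendsto_zero]
  refine squeeze_zero (fun n => norm_nonneg _) (fun n => ?_) hz
  obtain ⟨ξ, -, hξ⟩ := taylor_mean_remainder_lagrange_iteratedDeriv (n := n) hne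
    (f := f) (by exact_mod_cast (hfn (n + 1)).contDiffOn)
  have hT : taylorWithinEval f n (uIcc x (x + y)) x (x + y) =
      ∑ k ∈ Finset.range (n + 1), iteratedDeriv k f x / k.factorial * y ^ k := by
    rw [taylor_within_apply]
    refine Finset.sum_congr rfl fun k _ => ?_
    rw [iteratedDerivWithin_eq_iteratedDeriv (uniqueDiffOn_uIcc hne) (hfn k).contDiffAt
      left_mem_uIcc, smul_eq_mul, add_sub_cancel_left]
    ring
  rw [hT] at hξ
  rw [Real.norm_eq_abs, abs_sub_comm, hξ, add_sub_cancel_left]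
  refine (hle (n + 1) ξ).trans_eq ?_
  ring

lemma analyticOnNhd_of_derivative_bound {f : ℝ → ℝ} (hf : ContDiff ℝ (⊤ : ℕ∞) f) {C R : ℝ}
    (hR : 0 < R)
    (hb : ∀ (n : ℕ) (x : ℝ), |iteratedDeriv n f x| ≤ C * (n + 1) * (n.factorial / R ^ n)) :
    AnalyticOnNhd ℝ f univ := by
  intro x _
  have hC : 0 ≤ C := by simpa using (abs_nonneg _).trans (hb 0 0)
  set c : ℕ → ℝ := fun n => iteratedDeriv n f x / n.factorial with hc
  refine ⟨FormalMultilinearSeries.ofScalars ℝ c, ENNReal.ofReal (R / 2), ?_⟩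
  refine ⟨?_, by simpa using hR, fun {y} hy => ?_⟩
  · refine FormalMultilinearSeries.le_radius_of_bound _ C fun n => ?_
    rw [FormalMultilinearSeries.ofScalars_norm, Real.coe_toNNReal _ (by positivity), hc]
    have hn : (0 : ℝ) < n.factorial := by exact_mod_cast n.factorial_pos
    have h2 : (n : ℝ) + 1 ≤ 2 ^ n := by exact_mod_cast Nat.succ_le_of_lt (Nat.lt_two_pow_self)
    rw [norm_div, Real.norm_eq_abs, Real.norm_eq_abs, Nat.abs_cast]
    calc |iteratedDeriv n f x| / n.factorial * (R / 2) ^ n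
        ≤ C * (n + 1) * (n.factorial / R ^ n) / n.factorial * (R / 2) ^ n := by
          gcongr
          exact hb n x
      _ = C * ((n + 1) / 2 ^ n) := by rw [div_pow]; field_simp
      _ ≤ C * 1 := by
          gcongr
          rw [div_le_one (by positivity)]
          exact h2
      _ = C := mul_one C
  · have hy' : |y| < R := by
      have h1 : ‖y‖ < R / 2 := by
        have := hy
        rw [Metric.mem_eball, edist_zero_right, ← ofReal_norm] at this
        exact (ENNReal.ofReal_lt_ofReal_iff (by positivity)).1 this
      rw [Real.norm_eq_abs] at h1
      linarith
    convert! hasSum_taylor hf hR hb x hy' using 2 with n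
    rw [FormalMultilinearSeries.ofScalars_apply_eq, smul_eq_mul]

namespace IsHInf

variable {f : ℝ → ℝ} {A R : ℝ}

lemma abs_iteratedDeriv_le_of_le (hf : IsHInf f) (hR : 0 < R) (hA : 0 ≤ A)
    (ha : ∀ j : ℕ, derivNorm j f ≤ A * (j.factorial / R ^ j)) (n : ℕ) (x : ℝ) :
    |iteratedDeriv n f x| ≤ A * (1 + 1 / R) * (n + 1) * (n.factorial / R ^ n) := by
  refine (hf.abs_le n x).trans ((add_le_add (ha n) (ha (n + 1))).trans ?_)
  have e : A * (n.factorial / R ^ n) + A * ((n + 1).factorial / R ^ (n + 1)) =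
      A * (n.factorial / R ^ n) * (1 + (n + 1) / R) := by
    rw [Nat.factorial_succ, pow_succ]
    push_cast
    field_simp
  have h1 : 1 + (n + 1) / R ≤ (1 + 1 / R) * (n + 1) := by
    have : (0 : ℝ) ≤ n := n.cast_nonneg
    have e2 : (1 + 1 / R) * (n + 1) = 1 + (n + 1) / R + n := by ring
    linarith
  rw [e]
  calc _ ≤ A * (n.factorial / R ^ n) * ((1 + 1 / R) * (n + 1)) := by gcongr
    _ = _ := by ring

lemma analyticOnNhd_of_le (hf : IsHInf f) (hR : 0 < R) (hA : 0 ≤ A)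
    (ha : ∀ j : ℕ, derivNorm j f ≤ A * (j.factorial / R ^ j)) : AnalyticOnNhd ℝ f univ :=
  analyticOnNhd_of_derivative_bound hf.smooth hR (hf.abs_iteratedDeriv_le_of_le hR hA ha)

lemma derivNorm_burgers_le (hf : IsHInf f) (hR : 0 < R) (hA : 0 ≤ A)
    (ha : ∀ j : ℕ, derivNorm j f ≤ A * (j.factorial / R ^ j)) (n : ℕ) :
    derivNorm n (fun x => -(f x * _root_.deriv f x)) ≤
      A ^ 2 * (1 + 1 / R) / R * ((n + 1) ^ 3 * (n.factorial / R ^ n)) := by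
  rw [derivNorm_neg, derivNorm, hf.iteratedDeriv_mul hf.deriv]
  refine (L2Norm_sum_le _ fun i _ => (hf.memLp_mul hf.deriv i (n - i)).const_mul _).trans ?_
  have hterm : ∀ i ∈ Finset.range (n + 1), L2Norm (fun x => (n.choose i : ℝ) *
      (iteratedDeriv i f x * iteratedDeriv (n - i) (_root_.deriv f) x)) ≤
      A ^ 2 * (1 + 1 / R) / R * ((n + 1) ^ 2 * (n.factorial / R ^ n)) := by
    intro i hi
    have hi : i ≤ n := Nat.lt_succ_iff.1 (Finset.mem_range.1 hi)
    obtain ⟨l, rfl⟩ := Nat.exists_eq_add_of_le hi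
    rw [L2Norm_const_mul, Nat.abs_cast, Nat.add_sub_cancel_left, iteratedDeriv_deriv]
    have h1 : L2Norm (fun x => iteratedDeriv i f x * iteratedDeriv (l + 1) f x) ≤
        (A * (1 + 1 / R) * (i + 1) * (i.factorial / R ^ i)) * derivNorm (l + 1) f :=
      L2Norm_mul_le (hf.abs_iteratedDeriv_le_of_le hR hA ha i) (hf.memLp (l + 1))
    have h2 := ha (l + 1)
    have hc : ((i + l).choose i : ℝ) * (i.factorial * l.factorial) = (i + l).factorial := by
      have := Nat.choose_mul_factorial_mul_factorial hi
      rw [Nat.add_sub_cancel_left] at this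
      rw [← mul_assoc]
      exact_mod_cast this
    have hil : ((i : ℝ) + 1) * (l + 1) ≤ (((i + l : ℕ) : ℝ) + 1) ^ 2 := by
      push_cast
      have : (0 : ℝ) ≤ i := i.cast_nonneg
      have : (0 : ℝ) ≤ l := l.cast_nonneg
      nlinarith [mul_nonneg (i.cast_nonneg (α := ℝ)) (l.cast_nonneg (α := ℝ))]
    calc ((i + l).choose i : ℝ) * L2Norm (fun x => iteratedDeriv i f x * iteratedDeriv (l + 1) f x)
        ≤ ((i + l).choose i : ℝ) * ((A * (1 + 1 / R) * (i + 1) * (i.factorial / R ^ i)) *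
            (A * ((l + 1).factorial / R ^ (l + 1)))) := by
          gcongr
          exact h1.trans (by gcongr)
      _ = A ^ 2 * (1 + 1 / R) / R * (((i + 1) * (l + 1)) *
            ((((i + l).choose i : ℝ) * (i.factorial * l.factorial)) / R ^ (i + l))) := by
          rw [Nat.factorial_succ, pow_succ, pow_add]
          push_cast
          field_simp
      _ ≤ _ := by
          rw [hc]
          gcongr
  refine (Finset.sum_le_sum hterm).trans_eq ?_
  rw [Finset.sum_const, Finset.card_range, nsmul_eq_mul]
  push_cast
  ring

end IsHInf

/-! ### A priori bounds along the flow -/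

/-- Barrier principle: `f` stays below `B` when it starts below and cannot cross. -/
lemma le_of_barrier {f f' B B' : ℝ → ℝ} {T : ℝ}
    (hf : ∀ t ∈ Icc 0 T, HasDerivWithinAt f (f' t) (Icc 0 T) t) (h0 : f 0 ≤ B 0)
    (hB : ∀ t, HasDerivAt B (B' t) t) (h : ∀ t ∈ Ico 0 T, f t = B t → f' t < B' t) :
    ∀ t ∈ Icc 0 T, f t ≤ B t := by
  have hc : ContinuousOn f (Icc 0 T) := fun t ht => (hf t ht).continuousWithinAt
  exact image_le_of_deriv_right_lt_deriv_boundary hc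
    (fun t ht => (hf t (Ico_subset_Icc_self ht)).mono_of_mem_nhdsWithin
      (Icc_mem_nhdsGE_of_mem ht)) h0 hB h

lemma le_mul_exp_of_deriv_le {f f' : ℝ → ℝ} {T L : ℝ}
    (hf : ∀ t ∈ Icc 0 T, HasDerivWithinAt f (f' t) (Icc 0 T) t)
    (h : ∀ t ∈ Icc 0 T, f' t ≤ L * f t) :
    ∀ t ∈ Icc 0 T, f t ≤ f 0 * Real.exp (L * t) := by
  have hE : ∀ t : ℝ, HasDerivAt (fun t => Real.exp (-(L * t))) (Real.exp (-(L * t)) * -L) t :=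
    fun t => by simpa using (((hasDerivAt_id t).const_mul L).neg).exp
  have hg : ∀ t ∈ Icc 0 T, HasDerivWithinAt (fun t => f t * Real.exp (-(L * t)))
      (f' t * Real.exp (-(L * t)) + f t * (Real.exp (-(L * t)) * -L)) (Icc 0 T) t :=
    fun t ht => (hf t ht).mul (hE t).hasDerivWithinAt
  have hc : ContinuousOn (fun t => f t * Real.exp (-(L * t))) (Icc 0 T) :=
    fun t ht => (hg t ht).continuousWithinAt
  intro t ht
  have := image_le_of_deriv_right_le_deriv_boundary (B := fun _ => f 0) (B' := fun _ => 0) hc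
    (fun t ht => (hg t (Ico_subset_Icc_self ht)).mono_of_mem_nhdsWithin
      (Icc_mem_nhdsGE_of_mem ht)) (by simp) continuousOn_const
    (fun t _ => hasDerivWithinAt_const _ _ _) (fun t ht => by
      have h1 := h t (Ico_subset_Icc_self ht)
      have h2 := Real.exp_pos (-(L * t))
      nlinarith) ht
  have h2 : f t * Real.exp (-(L * t)) * Real.exp (L * t) ≤ f 0 * Real.exp (L * t) := by
    gcongr
  rwa [mul_assoc, ← Real.exp_add, neg_add_cancel, Real.exp_zero, mul_one] at h2

/-- The rate of change of `‖D^n f‖²` along the flow of Burgers' equation. -/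
def energyRate (n : ℕ) (f : ℝ → ℝ) : ℝ :=
  2 * ∫ x, iteratedDeriv n f x * iteratedDeriv n (fun x => -(f x * deriv f x)) x

namespace IsC1Curve

variable {α ρ T : ℝ} {u v : ℝ → ℝ → ℝ}

lemma hasDerivWithinAt_energy (h : IsC1Curve α ρ T u v) (hρ : 0 < ρ)
    (hb : ∀ t ∈ Icc 0 T, ∀ x, v t x + u t x * deriv (u t) x = 0) (n : ℕ) :
    ∀ t ∈ Icc 0 T, HasDerivWithinAt (fun s => derivNorm n (u s) ^ 2) (energyRate n (u t))
      (Icc 0 T) t := by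
  intro t ht
  have hv : v t = fun x => -(u t x * deriv (u t) x) := by
    ext x; linarith [hb t ht x]
  have := h.hasDerivWithinAt_derivNorm_sq hρ ht n
  rwa [hv] at this

/-- The first three energies close among themselves: `Q' ≤ 14 Q^{3/2}` for the sum `Q` of squares,
so that `Q` stays below the barrier `q² e^{29qt}` as long as the latter is below `4q²`. -/
lemma sum_sq_le (h : IsC1Curve α ρ T u v) (hρ : 0 < ρ)
    (hb : ∀ t ∈ Icc 0 T, ∀ x, v t x + u t x * deriv (u t) x = 0) {q : ℝ}
    (hq : H2Norm (u 0) < q) (hqT : 29 * q * T ≤ 1) :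
    ∀ t ∈ Icc 0 T, ∑ n ∈ Finset.range 3, derivNorm n (u t) ^ 2 ≤ (2 * q) ^ 2 := by
  have hq0 : 0 < q := lt_of_le_of_lt (Finset.sum_nonneg fun n _ => derivNorm_nonneg n _) hq
  have hexp : ∀ t ∈ Icc 0 T, q ^ 2 * Real.exp (29 * q * t) ≤ (2 * q) ^ 2 := by
    intro t ht
    have h1 : Real.exp (29 * q * t) ≤ Real.exp 1 := by
      refine Real.exp_le_exp.2 (le_trans ?_ hqT)
      have := ht.2
      gcongr
    have h2 := Real.exp_one_lt_d9
    nlinarith [sq_nonneg q]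
  intro t ht
  refine le_trans ?_ (hexp t ht)
  refine le_of_barrier (f := fun t => ∑ n ∈ Finset.range 3, derivNorm n (u t) ^ 2)
    (f' := fun t => ∑ n ∈ Finset.range 3, energyRate n (u t))
    (B := fun t => q ^ 2 * Real.exp (29 * q * t))
    (B' := fun t => q ^ 2 * (Real.exp (29 * q * t) * (29 * q))) ?_ ?_ ?_ ?_ t ht
  · intro t ht
    exact HasDerivWithinAt.fun_sum fun n _ => h.hasDerivWithinAt_energy hρ hb n t ht
  · unfold H2Norm at hq
    simp only [Finset.sum_range_succ, Finset.sum_range_zero, zero_add] at hq ⊢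
    have a0 := derivNorm_nonneg 0 (u 0)
    have a1 := derivNorm_nonneg 1 (u 0)
    have a2 := derivNorm_nonneg 2 (u 0)
    simp only [mul_zero, Real.exp_zero, mul_one]
    nlinarith [mul_nonneg a0 a1, mul_nonneg a0 a2, mul_nonneg a1 a2]
  · intro t
    exact (by simpa using ((hasDerivAt_id t).const_mul (29 * q)).exp.const_mul (q ^ 2))
  · intro t ht hQ
    have htc := Ico_subset_Icc_self ht
    have hf := (h.mem t htc).isHInf
    set Q := ∑ n ∈ Finset.range 3, derivNorm n (u t) ^ 2 with hQd
    have hQ4 : Q ≤ (2 * q) ^ 2 := hQ.trans_le (hexp t htc)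
    have hQpos : 0 < Q := by rw [hQ]; positivity
    have a1 := derivNorm_nonneg 1 (u t)
    have a2 := derivNorm_nonneg 2 (u t)
    have hQ12 : derivNorm 1 (u t) ^ 2 + derivNorm 2 (u t) ^ 2 ≤ Q := by
      rw [hQd]
      simp only [Finset.sum_range_succ, Finset.sum_range_zero, zero_add]
      nlinarith [sq_nonneg (derivNorm 0 (u t))]
    have hm : derivNorm 1 (u t) + derivNorm 2 (u t) ≤ 4 * q := by
      refine abs_le_of_sq_le_sq' ?_ (by positivity) |>.2
      nlinarith [sq_nonneg (derivNorm 1 (u t) - derivNorm 2 (u t))]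
    have hsup : ∀ x, |deriv (u t) x| ≤ 4 * q := fun x => by
      simpa using (hf.abs_le 1 x).trans hm
    have hE : ∑ n ∈ Finset.range 3, energyRate n (u t) ≤ 7 * (4 * q) * Q := by
      rw [hQd, Finset.mul_sum]
      exact Finset.sum_le_sum fun n hn =>
        hf.energy_low hsup (by have := Finset.mem_range.1 hn; omega)
    have hlt : 7 * (4 * q) * Q < Q * (29 * q) := by nlinarith [mul_pos hq0 hQpos]
    refine (hE.trans_lt hlt).trans_eq ?_
    rw [hQ]
    ring

/-- Bound for the slope on the time interval on which `‖u‖_{H²}` is under control. -/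
lemma slope_le (h : IsC1Curve α ρ T u v) (hρ : 0 < ρ)
    (hb : ∀ t ∈ Icc 0 T, ∀ x, v t x + u t x * deriv (u t) x = 0) (hT : 0 < T)
    (hhT : 100 * H2Norm (u 0) * T ≤ 1) :
    ∀ t ∈ Icc 0 T, ∀ x, |deriv (u t) x| ≤ 4 * H2Norm (u 0) := by
  intro t ht x
  refine le_of_forall_pos_le_add fun ε hε => ?_
  -- the barrier needs `q > ‖u(0)‖_{H²}` strictly, also for zero data: take `q = ‖u(0)‖_{H²} + δ`
  set δ := min (ε / 4) (1 / (100 * T)) with hδ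
  have hδ0 : 0 < δ := by positivity
  have h1 : δ ≤ ε / 4 := min_le_left _ _
  have h2 : δ * T ≤ 1 / 100 := by
    calc δ * T ≤ 1 / (100 * T) * T := by gcongr; exact min_le_right _ _
      _ = _ := by field_simp
  have hq := h.sum_sq_le hρ hb (q := H2Norm (u 0) + δ) (by linarith) (by nlinarith) t ht
  have hq0 : 0 ≤ H2Norm (u 0) := Finset.sum_nonneg fun n _ => derivNorm_nonneg n _
  have hm : derivNorm 1 (u t) + derivNorm 2 (u t) ≤ 4 * (H2Norm (u 0) + δ) := by
    refine abs_le_of_sq_le_sq' ?_ (by positivity) |>.2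
    simp only [Finset.sum_range_succ, Finset.sum_range_zero, zero_add] at hq
    nlinarith [sq_nonneg (derivNorm 1 (u t) - derivNorm 2 (u t)), sq_nonneg (derivNorm 0 (u t))]
  have := ((h.mem t ht).isHInf.abs_le 1 x).trans hm
  rw [iteratedDeriv_one] at this
  linarith

/-- With the slope controlled, the energies of order at most `2` obey a linear Gronwall inequality;
the time restriction is what makes the resulting factor at most `c₀`. -/
lemma derivNorm_le_of_le_two (h : IsC1Curve α ρ T u v) (hρ : 0 < ρ)
    (hb : ∀ t ∈ Icc 0 T, ∀ x, v t x + u t x * deriv (u t) x = 0) (hT : 0 < T) {c₀ : ℝ}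
    (hc₀ : 1 < c₀) (hhT : 100 * c₀ * H2Norm (u 0) * T ≤ Real.log c₀) {n : ℕ} (hn : n ≤ 2) :
    ∀ t ∈ Icc 0 T, derivNorm n (u t) ≤ c₀ * derivNorm n (u 0) := by
  intro t ht
  have hq0 : 0 ≤ H2Norm (u 0) := Finset.sum_nonneg fun n _ => derivNorm_nonneg n _
  have hlog : Real.log c₀ ≤ c₀ := by linarith [Real.log_le_sub_one_of_pos (by linarith : 0 < c₀)]
  have h1 : 100 * H2Norm (u 0) * T ≤ 1 := by
    have : c₀ * (100 * H2Norm (u 0) * T) ≤ c₀ * 1 := by linarith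
    exact le_of_mul_le_mul_left this (by linarith)
  have hm := h.slope_le hρ hb hT h1
  have hg := le_mul_exp_of_deriv_le (h.hasDerivWithinAt_energy hρ hb n)
    (fun t ht => (h.mem t ht).isHInf.energy_low (hm t ht) hn) t ht
  have hexp : Real.exp (7 * (4 * H2Norm (u 0)) * t) ≤ c₀ ^ 2 := by
    have h2 : 7 * (4 * H2Norm (u 0)) * t ≤ Real.log c₀ + Real.log c₀ := by
      have h3 : 7 * (4 * H2Norm (u 0)) * t ≤ 28 * (H2Norm (u 0) * T) := by
        have := mul_le_mul_of_nonneg_left ht.2 hq0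
        linarith
      have h4 : 0 ≤ H2Norm (u 0) * T := by positivity
      nlinarith
    calc _ ≤ Real.exp (Real.log c₀ + Real.log c₀) := Real.exp_le_exp.2 h2
      _ = c₀ ^ 2 := by rw [Real.exp_add, Real.exp_log (by linarith)]; ring
  have a0 := derivNorm_nonneg n (u 0)
  refine abs_le_of_sq_le_sq' ?_ (by positivity) |>.2
  calc derivNorm n (u t) ^ 2 ≤ _ := hg
    _ ≤ derivNorm n (u 0) ^ 2 * c₀ ^ 2 := by gcongr
    _ = _ := by ring

/-- Propagation of the analytic bounds: once the exponential rate `Δ` beats the slope and the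
quadratic interaction, no derivative can be the first to cross its barrier. -/
lemma derivNorm_le_exp (h : IsC1Curve α ρ T u v) (hρ : 0 < ρ)
    (hb : ∀ t ∈ Icc 0 T, ∀ x, v t x + u t x * deriv (u t) x = 0) (hα : 2 < α) {R A K m Δ : ℝ}
    (hR : 0 < R) (hA : 0 < A) (hK0 : 0 < K)
    (hK : ConvolutionBound α K)
    (hm0 : 0 ≤ m) (hm : ∀ t ∈ Icc 0 T, ∀ x, |deriv (u t) x| ≤ m)
    (hΔ : 9 * m + 6 * A * (K * (1 + 2 / R) / R) < 2 * Δ)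
    (h0 : ∀ J, derivNorm J (u 0) ≤ A * ((J.factorial : ℝ) / weight α J) * (1 / R ^ J))
    (h2 : ∀ t ∈ Icc 0 T, derivNorm 2 (u t) ≤
      A * (((2 : ℕ).factorial : ℝ) / weight α 2) * (1 / R ^ 2)) (J : ℕ) (hJ : 2 ≤ J) :
    ∀ t ∈ Icc 0 T, derivNorm J (u t) ≤
      A * Real.exp (Δ * t) ^ (J - 2) * ((J.factorial : ℝ) / weight α J) * (1 / R ^ J) := by
  have hΔ0 : 0 ≤ Δ := by
    have : 0 ≤ 6 * A * (K * (1 + 2 / R) / R) := by positivity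
    linarith
  induction J using Nat.strong_induction_on with
  | _ J ih =>
  rcases hJ.eq_or_lt with rfl | hJ3
  · simpa using h2
  set c : ℝ := A * ((J.factorial : ℝ) / weight α J) * (1 / R ^ J) with hc
  have hw := weight_pos α J
  have hn : (0 : ℝ) < J.factorial := by exact_mod_cast J.factorial_pos
  have hcpos : 0 < c := by positivity
  have hcomm : ∀ t, A * Real.exp (Δ * t) ^ (J - 2) * ((J.factorial : ℝ) / weight α J) * (1 / R ^ J)
      = c * Real.exp (Δ * t) ^ (J - 2) := fun t => by rw [hc]; ring
  set p : ℝ := ((J - 2 : ℕ) : ℝ) with hp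
  have hpJ : (J : ℝ) = p + 2 := by
    rw [hp]
    exact_mod_cast (by omega : J = J - 2 + 2)
  have hp1 : 1 ≤ p := by rw [hp]; exact_mod_cast (by omega : 1 ≤ J - 2)
  have hX : ∀ t, Real.exp (Δ * t) ^ (J - 2) = Real.exp (p * (Δ * t)) := fun t => by
    rw [hp, Real.exp_nat_mul]
  have hBsq : ∀ t, c ^ 2 * Real.exp (2 * p * Δ * t) = (c * Real.exp (Δ * t) ^ (J - 2)) ^ 2 := by
    intro t
    rw [hX, mul_pow c, ← Real.exp_nat_mul (p * (Δ * t))]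
    congr 2
    push_cast
    ring
  have key := le_of_barrier (B := fun t => c ^ 2 * Real.exp (2 * p * Δ * t))
    (B' := fun t => c ^ 2 * (Real.exp (2 * p * Δ * t) * (2 * p * Δ)))
    (h.hasDerivWithinAt_energy hρ hb J) (by
      have := derivNorm_nonneg J (u 0)
      have := h0 J
      simp only [mul_zero, Real.exp_zero, mul_one]
      gcongr) (fun t => by
      simpa using ((hasDerivAt_id t).const_mul (2 * p * Δ)).exp.const_mul (c ^ 2))
    (fun t ht htouch => ?_)
  · intro t ht
    rw [hcomm]
    have := key t ht
    rw [hBsq] at this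
    exact abs_le_of_sq_le_sq' this (by positivity) |>.2
  · have htc := Ico_subset_Icc_self ht
    have hf := (h.mem t htc).isHInf
    have heq : derivNorm J (u t) = c * Real.exp (Δ * t) ^ (J - 2) := by
      rw [hBsq] at htouch
      exact (sq_eq_sq₀ (derivNorm_nonneg _ _) (by positivity)).1 htouch
    have hX1 : 1 ≤ Real.exp (Δ * t) := Real.one_le_exp (mul_nonneg hΔ0 ht.1)
    have hall : ∀ j, 2 ≤ j → j ≤ J → derivNorm j (u t) ≤
        A * Real.exp (Δ * t) ^ (j - 2) * ((j.factorial : ℝ) / weight α j) * (1 / R ^ j) := by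
      intro j hj2 hjJ
      rcases hjJ.eq_or_lt with rfl | hlt
      · rw [hcomm, heq]
      · exact ih j hlt hj2 t htc
    have he := hf.energy_high hα hR hA.le hX1 hK (hm t htc) hJ3 hall
    rw [hcomm, ← heq] at he
    have hpos : 0 < derivNorm J (u t) := by rw [heq]; positivity
    have hB : c ^ 2 * (Real.exp (2 * p * Δ * t) * (2 * p * Δ)) =
        derivNorm J (u t) ^ 2 * (2 * p * Δ) := by rw [heq, ← hBsq]; ring
    change energyRate J (u t) < _
    rw [hB]
    refine lt_of_le_of_lt he ?_
    rw [hpJ]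
    set κ := K * (1 + 2 / R) / R with hκ
    have hκ0 : 0 < κ := by positivity
    have e : m * derivNorm J (u t) ^ 2 + 2 * derivNorm J (u t) *
        ((p + 2 + 1) * m * derivNorm J (u t) + A * κ * (p + 2) * derivNorm J (u t)) =
        derivNorm J (u t) ^ 2 * ((2 * p + 7) * m + 2 * A * κ * (p + 2)) := by ring
    rw [e]
    have hAκ : 0 < A * κ := by positivity
    -- `J ≥ 3` means `p = J - 2 ≥ 1`, hence `2J + 3 ≤ 9p` and `J ≤ 3p`
    have hlin : (2 * p + 7) * m + 2 * A * κ * (p + 2) < 2 * p * Δ := by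
      have e1 : (2 * p + 7) * m ≤ p * (9 * m) := by nlinarith
      have e2 : 2 * A * κ * (p + 2) ≤ p * (6 * A * κ) := by nlinarith
      have e3 : p * (9 * m + 6 * A * κ) < p * (2 * Δ) := by
        apply mul_lt_mul_of_pos_left hΔ
        linarith
      linarith
    exact mul_lt_mul_of_pos_left hlin (by positivity)

/-- The derivative bounds in the form that also covers `J < 2` and vanishing data. -/
lemma derivNorm_le_exp_max (h : IsC1Curve α ρ T u v) (hρ : 0 < ρ)
    (hb : ∀ t ∈ Icc 0 T, ∀ x, v t x + u t x * deriv (u t) x = 0) (hα : 2 < α) {R A K m Δ : ℝ}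
    (hR : 0 < R) (hA : 0 ≤ A) (hK0 : 0 < K)
    (hK : ConvolutionBound α K)
    (hm0 : 0 ≤ m) (hm : ∀ t ∈ Icc 0 T, ∀ x, |deriv (u t) x| ≤ m)
    (hΔ : 9 * m + 6 * A * (K * (1 + 2 / R) / R) < 2 * Δ)
    (h0 : ∀ J, derivNorm J (u 0) ≤ A * ((J.factorial : ℝ) / weight α J) * (1 / R ^ J))
    (h2 : ∀ J ≤ 2, ∀ t ∈ Icc 0 T, derivNorm J (u t) ≤
      A * ((J.factorial : ℝ) / weight α J) * (1 / R ^ J)) (J : ℕ) :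
    ∀ t ∈ Icc 0 T, derivNorm J (u t) ≤ A * Real.exp (max ((J : ℝ) - 2) 0 * Δ * t) *
      ((J.factorial : ℝ) / weight α J) * (1 / R ^ J) := by
  intro t ht
  have hw := weight_pos α J
  rcases le_or_gt J 2 with hJ | hJ
  · have : max ((J : ℝ) - 2) 0 = 0 := max_eq_right (by
      have : (J : ℝ) ≤ 2 := by exact_mod_cast hJ
      linarith)
    simpa [this] using h2 J hJ t ht
  have hexp : Real.exp (max ((J : ℝ) - 2) 0 * Δ * t) = Real.exp (Δ * t) ^ (J - 2) := by
    rw [← Real.exp_nat_mul, Nat.cast_sub hJ.le, max_eq_left, mul_assoc]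
    · norm_num
    · have : (2 : ℝ) < J := by exact_mod_cast hJ
      linarith
  rw [hexp]
  set κ := K * (1 + 2 / R) / R with hκ
  -- the barrier argument needs a positive constant: let `a` decrease to `A`
  have hlim : Tendsto (fun a : ℝ => a * Real.exp (Δ * t) ^ (J - 2) *
      ((J.factorial : ℝ) / weight α J) * (1 / R ^ J)) (𝓝[>] A)
      (𝓝 (A * Real.exp (Δ * t) ^ (J - 2) * ((J.factorial : ℝ) / weight α J) * (1 / R ^ J))) := by
    refine Tendsto.mono_left (Continuous.tendsto ?_ A) nhdsWithin_le_nhds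
    fun_prop
  have hev : ∀ᶠ a in 𝓝[>] A, 9 * m + 6 * a * κ < 2 * Δ := by
    have hcont : Continuous fun a : ℝ => 9 * m + 6 * a * κ := by fun_prop
    exact nhdsWithin_le_nhds ((hcont.tendsto A).eventually_lt_const hΔ)
  refine ge_of_tendsto hlim ?_
  filter_upwards [hev, self_mem_nhdsWithin] with a ha hAa
  have hAa : A < a := hAa
  refine h.derivNorm_le_exp hρ hb hα hR (hA.trans_lt hAa) hK0 hK hm0 hm ha
    (fun J => (h0 J).trans ?_) (fun t ht => (h2 2 le_rfl t ht).trans ?_) J hJ.le t ht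
  · have := weight_pos α J
    gcongr
  · have := weight_pos α 2
    gcongr

end IsC1Curve

/-! ### Majorants for the Taylor coefficients in time -/

/-- `f ∈ H^∞` is majorized by the power series `∑ β j z^j`: every `D^j f` is bounded by `j! β j`,
both uniformly and in `L²(ℝ)`. -/
structure Majorized (f : ℝ → ℝ) (β : ℕ → ℝ) : Prop where
  isHInf : IsHInf f
  norm_le : ∀ j, derivNorm j f ≤ j.factorial * β j
  abs_le : ∀ j x, |iteratedDeriv j f x| ≤ j.factorial * β j

namespace Majorized

variable {f g : ℝ → ℝ} {β γ : ℕ → ℝ}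

lemma nonneg (h : Majorized f β) (j : ℕ) : 0 ≤ β j := by
  have h1 := (derivNorm_nonneg j f).trans (h.norm_le j)
  have hn : (0 : ℝ) < j.factorial := by exact_mod_cast j.factorial_pos
  exact nonneg_of_mul_nonneg_right h1 hn

lemma mono (h : Majorized f β) (hβ : ∀ j, β j ≤ γ j) : Majorized f γ :=
  ⟨h.isHInf, fun j => (h.norm_le j).trans (by gcongr; exact hβ j),
    fun j x => (h.abs_le j x).trans (by gcongr; exact hβ j)⟩

lemma const_mul (c : ℝ) (h : Majorized f β) :
    Majorized (fun x => c * f x) (fun j => |c| * β j) := by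
  refine ⟨h.isHInf.const_mul c, fun j => ?_, fun j x => ?_⟩
  · rw [IsHInf.derivNorm_const_mul]
    calc _ ≤ |c| * (j.factorial * β j) := by gcongr; exact h.norm_le j
      _ = _ := by ring
  · rw [IsHInf.iteratedDeriv_const_mul, abs_mul]
    calc _ ≤ |c| * (j.factorial * β j) := by gcongr; exact h.abs_le j x
      _ = _ := by ring

lemma add (hf : Majorized f β) (hg : Majorized g γ) :
    Majorized (fun x => f x + g x) (fun j => β j + γ j) := by
  refine ⟨hf.isHInf.add hg.isHInf, fun j => ?_, fun j x => ?_⟩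
  · rw [mul_add]
    exact (hf.isHInf.derivNorm_add_le hg.isHInf j).trans (add_le_add (hf.norm_le j) (hg.norm_le j))
  · rw [hf.isHInf.iteratedDeriv_add hg.isHInf, mul_add]
    exact (abs_add_le _ _).trans (add_le_add (hf.abs_le j x) (hg.abs_le j x))

lemma sum {ι : Type*} (s : Finset ι) {F : ι → ℝ → ℝ} {B : ι → ℕ → ℝ}
    (hF : ∀ i ∈ s, Majorized (F i) (B i)) :
    Majorized (fun x => ∑ i ∈ s, F i x) (fun j => ∑ i ∈ s, B i j) := by
  classical
  induction s using Finset.induction_on with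
  | empty =>
    have h0 : ∀ j, iteratedDeriv j (fun _ : ℝ => (0 : ℝ)) = fun _ => 0 := fun j => by ext x; simp
    simp only [Finset.sum_empty]
    exact ⟨IsHInf.zero, fun j => by simp [derivNorm, h0, L2Norm], fun j x => by simp⟩
  | insert a s ha ih =>
    simp only [Finset.sum_insert ha]
    exact (hF a (by simp)).add (ih fun i hi => hF i (by simp [hi]))

lemma deriv (hf : Majorized f β) :
    Majorized (deriv f) (fun j => (j + 1) * β (j + 1)) := by
  have e : ∀ j : ℕ, (j.factorial : ℝ) * ((j + 1) * β (j + 1)) =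
      (j + 1).factorial * β (j + 1) := fun j => by
    rw [Nat.factorial_succ]; push_cast; ring
  refine ⟨hf.isHInf.deriv, fun j => ?_, fun j x => ?_⟩
  · rw [IsHInf.derivNorm_deriv, e]
    exact hf.norm_le (j + 1)
  · rw [IsHInf.iteratedDeriv_deriv, e]
    exact hf.abs_le (j + 1) x

/-- Majorants multiply like power series; this is the Leibniz formula. -/
lemma mul (hf : Majorized f β) (hg : Majorized g γ) :
    Majorized (fun x => f x * g x)
      (fun j => ∑ p ∈ Finset.HasAntidiagonal.antidiagonal j, β p.1 * γ p.2) := by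
  have e : ∀ j : ℕ, (j.factorial : ℝ) * ∑ p ∈ Finset.HasAntidiagonal.antidiagonal j, β p.1 * γ p.2 =
      ∑ i ∈ Finset.range (j + 1),
        (j.choose i : ℝ) * ((i.factorial * β i) * ((j - i).factorial * γ (j - i))) := by
    intro j
    rw [Finset.Nat.sum_antidiagonal_eq_sum_range_succ (fun a b => β a * γ b), Finset.mul_sum]
    refine Finset.sum_congr rfl fun i hi => ?_
    have hi : i ≤ j := Nat.lt_succ_iff.1 (Finset.mem_range.1 hi)
    rw [← Nat.choose_mul_factorial_mul_factorial hi]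
    push_cast
    ring
  have hβ := hf.nonneg
  have hγ := hg.nonneg
  refine ⟨hf.isHInf.mul hg.isHInf, fun j => ?_, fun j x => ?_⟩
  · rw [derivNorm, hf.isHInf.iteratedDeriv_mul hg.isHInf, e]
    refine (L2Norm_sum_le _ fun i _ =>
      (hf.isHInf.memLp_mul hg.isHInf i (j - i)).const_mul _).trans (Finset.sum_le_sum fun i _ => ?_)
    rw [L2Norm_const_mul, Nat.abs_cast]
    gcongr
    refine (L2Norm_mul_le (hf.abs_le i) (hg.isHInf.memLp (j - i))).trans ?_
    have := hβ i
    gcongr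
    exact hg.norm_le (j - i)
  · rw [hf.isHInf.iteratedDeriv_mul hg.isHInf, e]
    refine (Finset.abs_sum_le_sum_abs _ _).trans (Finset.sum_le_sum fun i _ => ?_)
    rw [abs_mul, abs_mul, Nat.abs_cast]
    have := hβ i
    gcongr
    · exact hf.abs_le i x
    · exact hg.abs_le (j - i) x

end Majorized

/-- The coefficients `w_n` of the formal solution `∑ t^n w_n` of Burgers' equation, written in the
conservation form `∂ₜu = - ½ ∂ₓ(u²)`, with `w_0 = f`. -/
def timeCoeff (f : ℝ → ℝ) : ℕ → ℝ → ℝ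
  | 0 => f
  | n + 1 => fun x => -(1 / (2 * ((n : ℝ) + 1))) *
      deriv (fun y => ∑ i : Fin (n + 1), timeCoeff f i y * timeCoeff f (n - i) y) x

lemma timeCoeff_zero (f : ℝ → ℝ) : timeCoeff f 0 = f := by rw [timeCoeff]

lemma timeCoeff_succ (f : ℝ → ℝ) (n : ℕ) :
    timeCoeff f (n + 1) = fun x => -(1 / (2 * ((n : ℝ) + 1))) *
      deriv (fun y => ∑ p ∈ Finset.HasAntidiagonal.antidiagonal n, timeCoeff f p.1 y * timeCoeff f p.2 y) x := by
  rw [timeCoeff]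
  ext x
  congr 3
  ext y
  rw [Finset.Nat.sum_antidiagonal_eq_sum_range_succ
    (fun a b => timeCoeff f a y * timeCoeff f b y), Finset.sum_range]

/-- `(1 - z)^{-(2a+1)} (1 - z)^{-(2b+1)} = (1 - z)^{-(2(a+b+1))}`, coefficientwise. -/
lemma sum_antidiagonal_choose_mul_choose (a b m : ℕ) :
    ∑ p ∈ Finset.HasAntidiagonal.antidiagonal m, ((2 * a + p.1).choose p.1 : ℝ) * ((2 * b + p.2).choose p.2) =
      ((2 * (a + b) + 1 + m).choose m : ℝ) := by
  have h := congrArg Units.val (PowerSeries.invOneSubPow_add (S := ℝ) (2 * a + 1) (2 * b + 1))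
  rw [Units.val_mul, show 2 * a + 1 + (2 * b + 1) = (2 * (a + b) + 1) + 1 by ring,
    PowerSeries.invOneSubPow_val_succ_eq_mk_add_choose,
    PowerSeries.invOneSubPow_val_succ_eq_mk_add_choose,
    PowerSeries.invOneSubPow_val_succ_eq_mk_add_choose] at h
  have h2 := congrArg (PowerSeries.coeff m) h
  rw [PowerSeries.coeff_mul] at h2
  simp only [PowerSeries.coeff_mk] at h2
  rw [← Nat.choose_symm_add, h2]
  refine Finset.sum_congr rfl fun p _ => ?_
  rw [← Nat.choose_symm_add, ← Nat.choose_symm_add]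

/-- The majorant is, up to scaling, the exact solution `W = ∑ Cat_n t^n (1 - z)^{-(2n+1)}` of
`∂ₜW = W ∂_z W` with data `1 / (1 - z)`. -/
lemma majorized_timeCoeff {f : ℝ → ℝ} {A y : ℝ} (h : Majorized f fun j => A * y ^ j) (n : ℕ) :
    Majorized (timeCoeff f n) fun j =>
      A ^ (n + 1) * catalan n * ((2 * n + j).choose j : ℝ) * y ^ (n + j) := by
  induction n using Nat.strong_induction_on with
  | _ n ih =>
  rcases n with _ | n
  · rw [timeCoeff_zero]
    refine h.mono fun j => ?_
    simp
  rw [timeCoeff_succ]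
  have h1 := ((Majorized.sum (Finset.HasAntidiagonal.antidiagonal n)
    (F := fun p y => timeCoeff f p.1 y * timeCoeff f p.2 y) (fun p hp => by
      have hp := Finset.HasAntidiagonal.mem_antidiagonal.1 hp
      exact (ih p.1 (by omega)).mul (ih p.2 (by omega)))).deriv).const_mul
        (-(1 / (2 * ((n : ℝ) + 1))))
  refine h1.mono fun j => le_of_eq ?_
  have e1 : ∀ p ∈ Finset.HasAntidiagonal.antidiagonal n, ∑ s ∈ Finset.HasAntidiagonal.antidiagonal (j + 1),
      A ^ (p.1 + 1) * catalan p.1 * ((2 * p.1 + s.1).choose s.1 : ℝ) * y ^ (p.1 + s.1) *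
      (A ^ (p.2 + 1) * catalan p.2 * ((2 * p.2 + s.2).choose s.2 : ℝ) * y ^ (p.2 + s.2)) =
      (A ^ (n + 2) * y ^ (n + (j + 1)) * ((2 * n + 1 + (j + 1)).choose (j + 1) : ℝ)) *
        (catalan p.1 * catalan p.2) := by
    intro p hp
    have hp := Finset.HasAntidiagonal.mem_antidiagonal.1 hp
    have := sum_antidiagonal_choose_mul_choose p.1 p.2 (j + 1)
    rw [hp] at this
    rw [← this, Finset.mul_sum, Finset.sum_mul]
    refine Finset.sum_congr rfl fun s hs => ?_
    have hs := Finset.HasAntidiagonal.mem_antidiagonal.1 hs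
    rw [← hs, ← hp]
    ring
  rw [Finset.sum_congr rfl e1, ← Finset.mul_sum]
  have e2 : ∑ p ∈ Finset.HasAntidiagonal.antidiagonal n, ((catalan p.1 : ℝ) * catalan p.2) = catalan (n + 1) := by
    rw [catalan_succ']; push_cast; rfl
  have e3 : ((j : ℝ) + 1) * ((2 * n + 1 + (j + 1)).choose (j + 1) : ℝ) =
      (2 * (n + 1)) * ((2 * (n + 1) + j).choose j : ℝ) := by
    have := Nat.choose_succ_right_eq (2 * (n + 1) + j) j
    rw [Nat.add_sub_cancel] at this
    rw [show 2 * n + 1 + (j + 1) = 2 * (n + 1) + j by ring]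
    have h2 : (((2 * (n + 1) + j).choose (j + 1) : ℕ) : ℝ) * ((j + 1 : ℕ) : ℝ) =
      ((2 * (n + 1) + j).choose j : ℝ) * ((2 * (n + 1) : ℕ) : ℝ) := by exact_mod_cast this
    push_cast at h2
    linarith
  have hn : (0 : ℝ) < 2 * (n + 1) := by positivity
  rw [e2, abs_neg, abs_of_pos (by positivity)]
  calc _ = 1 / (2 * ((n : ℝ) + 1)) * (((j : ℝ) + 1) *
        ((2 * n + 1 + (j + 1)).choose (j + 1) : ℝ)) *
        (A ^ (n + 2) * y ^ (n + (j + 1)) * catalan (n + 1)) := by ring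
    _ = _ := by
      rw [e3, show n + (j + 1) = n + 1 + j by ring, show n + 1 + 1 = n + 2 from rfl]
      field_simp

lemma catalan_le_four_pow (n : ℕ) : catalan n ≤ 4 ^ n := by
  have h1 : catalan n ≤ n.centralBinom := by
    rw [← succ_mul_catalan_eq_centralBinom]
    exact Nat.le_mul_of_pos_left _ n.succ_pos
  refine h1.trans ?_
  rw [Nat.centralBinom_eq_two_mul_choose]
  calc _ ≤ 2 ^ (2 * n) := Nat.choose_le_two_pow _ _
    _ = 4 ^ n := by rw [pow_mul]; norm_num

/-- Geometric bounds, uniform in the radius, for the coefficients of the formal solution. -/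
lemma majorized_timeCoeff_geometric {f : ℝ → ℝ} {A R σ : ℝ} (hσ : 0 < σ) (hσR : σ < R)
    (hA : 0 ≤ A) (h : Majorized f fun j => A * (1 / R) ^ j) : ∃ C q : ℝ, 0 ≤ C ∧ 0 ≤ q ∧
    ∀ n, Majorized (timeCoeff f n) fun j => C * q ^ n * (1 / σ) ^ j := by
  have hR : 0 < R := hσ.trans hσR
  set z := σ / R with hz
  have hz0 : 0 < z := by positivity
  have hz1 : z < 1 := (div_lt_one hR).2 hσR
  have hz2 : 0 < 1 - z := by linarith
  refine ⟨A / (1 - z), 4 * A * (1 / R) / (1 - z) ^ 2, by positivity, by positivity, fun n => ?_⟩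
  refine (majorized_timeCoeff h n).mono fun j => ?_
  have hs := hasSum_choose_mul_geometric_of_norm_lt_one (𝕜 := ℝ) (2 * n)
    (by rwa [Real.norm_of_nonneg hz0.le] : ‖z‖ < 1)
  -- a single term of the binomial series is at most its sum
  have h1 : ((2 * n + j).choose j : ℝ) * z ^ j ≤ 1 / (1 - z) ^ (2 * n + 1) := by
    have := le_hasSum hs j fun i _ => by positivity
    rwa [Nat.add_comm j, Nat.choose_symm_add] at this
  have hc : (catalan n : ℝ) ≤ 4 ^ n := by exact_mod_cast catalan_le_four_pow n
  have hzR : (1 / R) ^ j = z ^ j * (1 / σ) ^ j := by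
    rw [← mul_pow]; congr 1; rw [hz]; field_simp
  calc A ^ (n + 1) * catalan n * ((2 * n + j).choose j : ℝ) * (1 / R) ^ (n + j)
      = A ^ (n + 1) * (1 / R) ^ n * catalan n * (((2 * n + j).choose j : ℝ) * z ^ j) *
          (1 / σ) ^ j := by rw [pow_add (1 / R), hzR]; ring
    _ ≤ A ^ (n + 1) * (1 / R) ^ n * 4 ^ n * (1 / (1 - z) ^ (2 * n + 1)) * (1 / σ) ^ j := by
        gcongr
    _ = _ := by
        have e : (4 * A * (1 / R) / (1 - z) ^ 2) ^ n =
            4 ^ n * A ^ n * (1 / R) ^ n / (1 - z) ^ (2 * n) := by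
          rw [div_pow, mul_pow, mul_pow, ← pow_mul]
        rw [e, pow_succ A, pow_succ (1 - z)]
        field_simp

lemma MemB.majorized {α ρ R : ℝ} (hα : 0 ≤ α) {f : ℝ → ℝ} (h : MemB α ρ f) (hR : 0 < R)
    (hRρ : R < ρ) : ∃ A : ℝ, 0 ≤ A ∧ Majorized f fun j => A * (1 / R) ^ j := by
  have hρ : 0 < ρ := hR.trans hRρ
  set N := BNorm α ρ f with hN
  have hN0 : 0 ≤ N := BNorm_nonneg α hρ.le f
  have h1 : ∀ j : ℕ, derivNorm j f ≤ N * (j.factorial / ρ ^ j) := h.derivNorm_le_unweighted hα hρ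
  have h2 := h.isHInf.abs_iteratedDeriv_le_of_le hρ hN0 h1
  have hz0 : 0 < R / ρ := by positivity
  have hz1 : R / ρ < 1 := (div_lt_one hρ).2 hRρ
  have hs := summable_pow_mul_weight_mul_geometric 0 1 hz0 hz1
  set D := ∑' n : ℕ, ((n : ℝ) + 1) ^ 1 * weight 0 n * (R / ρ) ^ n with hD
  have hDj : ∀ j : ℕ, ((j : ℝ) + 1) * (R / ρ) ^ j ≤ D := fun j => by
    have := hs.le_tsum j fun i _ => by have := weight_pos 0 i; positivity
    simpa [weight, hD] using this
  have hD0 : 0 ≤ D := by simpa using (zero_le_one.trans (by simpa using hDj 0) : (0 : ℝ) ≤ D)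
  have e : ∀ j : ℕ, N * (1 + 1 / ρ) * (j + 1) * (j.factorial / ρ ^ j) ≤
      j.factorial * (N * (1 + 1 / ρ) * D * (1 / R) ^ j) := fun j => by
    calc N * (1 + 1 / ρ) * (j + 1) * (j.factorial / ρ ^ j)
        = N * (1 + 1 / ρ) * j.factorial * (((j : ℝ) + 1) * (R / ρ) ^ j) * (1 / R) ^ j := by
          rw [div_pow, div_pow, one_pow]; field_simp
      _ ≤ N * (1 + 1 / ρ) * j.factorial * D * (1 / R) ^ j := by
          gcongr
          exact hDj j
      _ = _ := by ring
  refine ⟨N * (1 + 1 / ρ) * D, by positivity, h.isHInf, fun j => ?_, fun j x => (h2 j x).trans (e j)⟩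
  refine (h1 j).trans (le_trans ?_ (e j))
  have h3 : (1 : ℝ) ≤ 1 + 1 / ρ := by
    have : 0 < 1 / ρ := by positivity
    linarith
  have h4 : (1 : ℝ) ≤ j + 1 := by linarith [(j.cast_nonneg : (0 : ℝ) ≤ j)]
  calc N * (j.factorial / ρ ^ j) = N * 1 * 1 * (j.factorial / ρ ^ j) := by ring
    _ ≤ _ := by gcongr

/-! ### Local existence -/

section Series

variable {w : ℕ → ℝ → ℝ} {C q σ : ℝ}

/-- Termwise differentiation of `∑ c_n w_n` for a family with geometric bounds. -/
lemma isHInf_tsum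
    (hw : ∀ n, Majorized (w n) fun j => C * q ^ n * (1 / σ) ^ j) {c : ℕ → ℝ}
    (hc : Summable fun n => |c n| * q ^ n) :
    (∀ j x, HasSum (fun n => c n * iteratedDeriv j (w n) x)
      (iteratedDeriv j (fun x => ∑' n, c n * w n x) x)) ∧
    IsHInf (fun x => ∑' n, c n * w n x) ∧
    ∀ j, derivNorm j (fun x => ∑' n, c n * w n x) ≤
      C * (∑' n, |c n| * q ^ n) * (j.factorial * (1 / σ) ^ j) := by
  have hbs : ∀ j : ℕ, Summable fun n => (C * (j.factorial * (1 / σ) ^ j)) * (|c n| * q ^ n) :=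
    fun j => hc.mul_left _
  have hb : ∀ (j n : ℕ) x, |c n * iteratedDeriv j (w n) x| ≤
      (C * (j.factorial * (1 / σ) ^ j)) * (|c n| * q ^ n) := fun j n x => by
    rw [abs_mul]
    calc _ ≤ |c n| * (j.factorial * (C * q ^ n * (1 / σ) ^ j)) := by
          gcongr; exact (hw n).abs_le j x
      _ = _ := by ring
  have hsm : ∀ n, ContDiff ℝ (⊤ : ℕ∞) (fun x => c n * w n x) :=
    fun n => ((hw n).isHInf.const_mul (c n)).smooth
  have hF : ∀ (k n : ℕ) (x : ℝ), (k : ℕ∞) ≤ (⊤ : ℕ∞) →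
      ‖iteratedFDeriv ℝ k (fun x => c n * w n x) x‖ ≤
        (C * (k.factorial * (1 / σ) ^ k)) * (|c n| * q ^ n) := fun k n x _ => by
    rw [norm_iteratedFDeriv_eq_norm_iteratedDeriv, IsHInf.iteratedDeriv_const_mul]
    exact hb k n x
  have hsum : ∀ j x, HasSum (fun n => c n * iteratedDeriv j (w n) x)
      (iteratedDeriv j (fun x => ∑' n, c n * w n x) x) := by
    intro j x
    have hs : Summable fun n => c n * iteratedDeriv j (w n) x :=
      Summable.of_norm_bounded (hbs j) fun n => hb j n x
    have hs' : Summable fun n => iteratedFDeriv ℝ j (fun x => c n * w n x) x :=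
      Summable.of_norm_bounded (hbs j) fun n => hF j n x le_top
    have h1 : iteratedDeriv j (fun x => ∑' n, c n * w n x) x =
        ∑' n, c n * iteratedDeriv j (w n) x := by
      rw [iteratedDeriv_eq_iteratedFDeriv,
        iteratedFDeriv_tsum_apply hsm (fun k _ => hbs k) hF le_top,
        ContinuousMultilinearMap.tsum_eval hs']
      congr 1
      ext n
      rw [← iteratedDeriv_eq_iteratedFDeriv, IsHInf.iteratedDeriv_const_mul]
    rw [h1]
    exact hs.hasSum
  have hL : ∀ j n, L2Norm (fun x => c n * iteratedDeriv j (w n) x) ≤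
      (C * (j.factorial * (1 / σ) ^ j)) * (|c n| * q ^ n) := fun j n => by
    rw [L2Norm_const_mul]
    calc _ ≤ |c n| * (j.factorial * (C * q ^ n * (1 / σ) ^ j)) := by
          gcongr; exact (hw n).norm_le j
      _ = _ := by ring
  have hLs : ∀ j, Summable fun n => L2Norm (fun x => c n * iteratedDeriv j (w n) x) := fun j =>
    Summable.of_nonneg_of_le (fun n => L2Norm_nonneg _) (hL j) (hbs j)
  have hmain := fun j => L2Norm_tsum_le (fun n => ((hw n).isHInf.memLp j).const_mul (c n)) (hLs j)
    (hsum j)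
  refine ⟨hsum, ⟨contDiff_tsum hsm (fun k _ => hbs k) hF, fun j => (hmain j).1⟩, fun j => ?_⟩
  refine (hmain j).2.trans (((hLs j).tsum_le_tsum (hL j) (hbs j)).trans_eq ?_)
  rw [tsum_mul_left]
  ring

lemma summable_geometric_weight (α : ℝ) {ρ : ℝ} (hρ : 0 < ρ) (hρσ : ρ < σ) (K : ℝ) :
    Summable fun n : ℕ =>
      K * (n.factorial * (1 / σ) ^ n) / (n.factorial : ℝ) * weight α n * ρ ^ n := by
  have hσ : 0 < σ := hρ.trans hρσ
  have h := (summable_pow_mul_weight_mul_geometric α 0 (div_pos hρ hσ)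
    ((div_lt_one hσ).2 hρσ)).mul_left K
  refine h.congr fun n => ?_
  have hn : (0 : ℝ) < n.factorial := by exact_mod_cast n.factorial_pos
  rw [div_pow, div_pow]
  field_simp
  simp

lemma memB_tsum (α : ℝ) {ρ : ℝ} (hρ : 0 < ρ) (hρσ : ρ < σ)
    (hw : ∀ n, Majorized (w n) fun j => C * q ^ n * (1 / σ) ^ j) {c : ℕ → ℝ}
    (hc : Summable fun n => |c n| * q ^ n) :
    MemB α ρ (fun x => ∑' n, c n * w n x) := by
  obtain ⟨-, h2, h3⟩ := isHInf_tsum hw hc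
  exact MemB.of_isHInf h2 hρ.le (fun n => BTerm_mono hρ.le (h3 n))
    (summable_geometric_weight α hρ hρσ _)

lemma tendsto_BNorm_tsum (α : ℝ) {ρ : ℝ} (hq : 0 ≤ q) (hρ : 0 < ρ) (hρσ : ρ < σ)
    (hw : ∀ n, Majorized (w n) fun j => C * q ^ n * (1 / σ) ^ j) {c : ℝ → ℕ → ℝ} {l : Filter ℝ}
    {M : ℕ → ℝ} (hM : Summable fun n => M n * q ^ n) (hcM : ∀ᶠ s in l, ∀ n, |c s n| ≤ M n)
    (hc0 : ∀ n, Tendsto (fun s => c s n) l (𝓝 0)) {F : ℝ → ℝ → ℝ}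
    (hF : ∀ᶠ s in l, F s = fun x => ∑' n, c s n * w n x) :
    Tendsto (fun s => BNorm α ρ (F s)) l (𝓝 0) := by
  have hdom : ∀ᶠ s in l, ∀ n, |c s n| * q ^ n ≤ M n * q ^ n := by
    filter_upwards [hcM] with s hs n
    gcongr
    exact hs n
  have hsummable : ∀ᶠ s in l, Summable fun n => |c s n| * q ^ n := by
    filter_upwards [hdom] with s hs
    exact Summable.of_nonneg_of_le (fun n => by positivity) hs hM
  have h1 : Tendsto (fun s => ∑' n, |c s n| * q ^ n) l (𝓝 0) := by
    have := tendsto_tsum_of_dominated_convergence (𝓕 := l) (f := fun s n => |c s n| * q ^ n)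
      (g := fun _ => 0) hM (fun n => by simpa using (hc0 n).abs.mul_const (q ^ n))
      (by
        filter_upwards [hdom] with s hs n
        rw [Real.norm_of_nonneg (by positivity)]
        exact hs n)
    simpa using this
  have hS := summable_geometric_weight α hρ hρσ 1
  set S := ∑' n : ℕ, (1 : ℝ) * (n.factorial * (1 / σ) ^ n) / (n.factorial : ℝ) * weight α n * ρ ^ n
    with hSd
  have h2 : Tendsto (fun s => C * (∑' n, |c s n| * q ^ n) * S) l (𝓝 0) := by
    simpa using (h1.const_mul C).mul_const S
  refine tendsto_of_tendsto_of_tendsto_of_le_of_le' tendsto_const_nhds h2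
    (Eventually.of_forall fun s => BNorm_nonneg α hρ.le _) ?_
  filter_upwards [hsummable, hF] with s hs hFs
  obtain ⟨-, -, h3⟩ := isHInf_tsum hw hs
  have hmem := memB_tsum α hρ hρσ hw hs
  rw [hFs, hSd, ← tsum_mul_left]
  refine hmem.summable.tsum_le_tsum (fun n => ?_) (hS.mul_left _)
  refine (BTerm_mono hρ.le (h3 n)).trans_eq ?_
  ring

end Series

lemma IsHInf.hasDerivAt_zero {f : ℝ → ℝ} (hf : IsHInf f) (x : ℝ) :
    HasDerivAt f (_root_.deriv f x) x := by simpa using hf.hasDerivAt 0 x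

/-- The recursion for the coefficients in non-conservative form. -/
lemma timeCoeff_recursion {f : ℝ → ℝ} (h : ∀ n, IsHInf (timeCoeff f n)) (n : ℕ) (x : ℝ) :
    ((n : ℝ) + 1) * timeCoeff f (n + 1) x = -∑ p ∈ Finset.HasAntidiagonal.antidiagonal n,
      timeCoeff f p.1 x * deriv (timeCoeff f p.2) x := by
  have hd : HasDerivAt (fun y => ∑ p ∈ Finset.HasAntidiagonal.antidiagonal n,
      timeCoeff f p.1 y * timeCoeff f p.2 y)
      (∑ p ∈ Finset.HasAntidiagonal.antidiagonal n, (deriv (timeCoeff f p.1) x * timeCoeff f p.2 x +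
        timeCoeff f p.1 x * deriv (timeCoeff f p.2) x)) x :=
    HasDerivAt.fun_sum fun p _ => ((h p.1).hasDerivAt_zero x).mul ((h p.2).hasDerivAt_zero x)
  rw [timeCoeff_succ]
  simp only
  rw [hd.deriv, Finset.sum_add_distrib]
  have hsw : ∑ p ∈ Finset.HasAntidiagonal.antidiagonal n,
      deriv (timeCoeff f p.1) x * timeCoeff f p.2 x =
      ∑ p ∈ Finset.HasAntidiagonal.antidiagonal n,
        timeCoeff f p.1 x * deriv (timeCoeff f p.2) x := by
    rw [← Finset.Nat.sum_antidiagonal_swap]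
    exact Finset.sum_congr rfl fun p _ => mul_comm _ _
  rw [hsw]
  have : (n : ℝ) + 1 ≠ 0 := by positivity
  field_simp
  ring

/-- Local existence in every smaller ball, by summing the power series in time. -/
lemma exists_isSolution {α ρ₀ ρ : ℝ} (hα : 0 ≤ α) (hρ : 0 < ρ) (hρρ₀ : ρ < ρ₀) {u₀ : ℝ → ℝ}
    (h : MemB α ρ₀ u₀) : ∃ T : ℝ, 0 < T ∧ ∃ u : ℝ → ℝ → ℝ, IsSolution α ρ T u₀ u := by
  obtain ⟨R, hρR, hRρ₀⟩ := exists_between hρρ₀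
  obtain ⟨σ, hρσ, hσR⟩ := exists_between hρR
  obtain ⟨A, hA, hmaj⟩ := h.majorized hα (hρ.trans hρR) hRρ₀
  obtain ⟨C, q, hC, hq, hw⟩ := majorized_timeCoeff_geometric (hρ.trans hρσ) hσR hA hmaj
  set w := timeCoeff u₀ with hwd
  set T : ℝ := 1 / (2 * (q + 1)) with hT
  have hT0 : 0 < T := by positivity
  have hTq : T * q < 1 := by
    rw [hT, one_div_mul_eq_div, div_lt_one (by positivity)]
    linarith
  have hTq0 : 0 ≤ T * q := by positivity
  have hsT : Summable fun n : ℕ => T ^ n * q ^ n := by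
    simpa [mul_pow] using summable_geometric_of_lt_one hTq0 hTq
  have hsT' : Summable fun n : ℕ => ((n : ℝ) * T ^ (n - 1)) * q ^ n := by
    have h1 := (summable_pow_mul_geometric_of_norm_lt_one (R := ℝ) 1
      (by rwa [Real.norm_of_nonneg hTq0])).mul_left T⁻¹
    refine h1.congr fun n => ?_
    rcases n with _ | n
    · simp
    · rw [Nat.add_sub_cancel, mul_pow, pow_succ T]
      field_simp
  have hpow : ∀ t ∈ Icc 0 T, ∀ n : ℕ, |t ^ n| ≤ T ^ n := fun t ht n => by
    rw [abs_pow, abs_of_nonneg ht.1]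
    exact pow_le_pow_left₀ ht.1 ht.2 n
  have hpow' : ∀ t ∈ Icc 0 T, ∀ n : ℕ, |(n : ℝ) * t ^ (n - 1)| ≤ n * T ^ (n - 1) :=
    fun t ht n => by
      rw [abs_mul, Nat.abs_cast]
      gcongr
      exact hpow t ht _
  have hsu : ∀ t ∈ Icc 0 T, Summable fun n : ℕ => |t ^ n| * q ^ n := fun t ht =>
    Summable.of_nonneg_of_le (fun n => by positivity)
      (fun n => by gcongr; exact hpow t ht n) hsT
  have hsv : ∀ t ∈ Icc 0 T, Summable fun n : ℕ => |(n : ℝ) * t ^ (n - 1)| * q ^ n := fun t ht =>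
    Summable.of_nonneg_of_le (fun n => by positivity)
      (fun n => by gcongr; exact hpow' t ht n) hsT'
  set u : ℝ → ℝ → ℝ := fun t x => ∑' n : ℕ, t ^ n * w n x with hu
  set v : ℝ → ℝ → ℝ := fun t x => ∑' n : ℕ, ((n : ℝ) * t ^ (n - 1)) * w n x with hv
  have hσ : 0 < σ := hρ.trans hρσ
  have sumu : ∀ t ∈ Icc 0 T, ∀ x, HasSum (fun n : ℕ => t ^ n * w n x) (u t x) := fun t ht x => by
    simpa using (isHInf_tsum hw (hsu t ht)).1 0 x
  have sumu' : ∀ t ∈ Icc 0 T, ∀ x, HasSum (fun n : ℕ => t ^ n * deriv (w n) x) (deriv (u t) x) :=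
    fun t ht x => by simpa using (isHInf_tsum hw (hsu t ht)).1 1 x
  have sumv : ∀ t ∈ Icc 0 T, ∀ x, HasSum (fun n : ℕ => ((n : ℝ) * t ^ (n - 1)) * w n x) (v t x) :=
    fun t ht x => by simpa using (isHInf_tsum hw (hsv t ht)).1 0 x
  refine ⟨T, hT0, u, ?_, v, ⟨fun t ht => memB_tsum α hρ hρσ hw (hsu t ht),
    fun t ht => memB_tsum α hρ hρσ hw (hsv t ht), fun t ht => ?_, fun t ht => ?_⟩, ?_⟩
  · ext x
    simp only [hu]
    rw [tsum_eq_single 0 (fun n hn => by simp [hn])]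
    simp [hwd, timeCoeff_zero]
  · refine tendsto_BNorm_tsum α hq hρ hρσ hw
      (c := fun s n => (s ^ n - t ^ n) / (s - t) - n * t ^ (n - 1))
      (M := fun n => n * T ^ (n - 1) + n * T ^ (n - 1)) ?_ ?_ (fun n => ?_) ?_
    · simpa only [add_mul] using hsT'.add hsT'
    · filter_upwards [eventually_mem_nhdsWithin] with s hs n
      refine (abs_sub _ _).trans (add_le_add ?_ (hpow' t ht n))
      have hst : 0 < |s - t| := abs_pos.2 (sub_ne_zero.2 hs.2)
      rw [abs_div, div_le_iff₀ hst]
      refine (abs_pow_sub_pow_le s t n).trans ?_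
      have hmax : max |s| |t| ≤ T := by
        rw [abs_of_nonneg hs.1.1, abs_of_nonneg ht.1]
        exact max_le hs.1.2 ht.2
      calc |s - t| * n * max |s| |t| ^ (n - 1) ≤ |s - t| * n * T ^ (n - 1) := by gcongr
        _ = _ := by ring
    · have h1 := ((hasDerivAt_pow n t).hasDerivWithinAt (s := Icc 0 T))
      rw [hasDerivWithinAt_iff_tendsto_slope] at h1
      have h2 := h1.sub_const ((n : ℝ) * t ^ (n - 1))
      rw [sub_self] at h2
      refine h2.congr fun s => ?_
      rw [slope_def_field]
    · filter_upwards [eventually_mem_nhdsWithin] with s hs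
      ext x
      have h1 := (((sumu s hs.1 x).sub (sumu t ht x)).div_const (s - t)).sub (sumv t ht x)
      rw [← h1.tsum_eq]
      congr 1
      ext n
      ring
  · refine tendsto_BNorm_tsum α hq hρ hρσ hw
      (c := fun s n => n * s ^ (n - 1) - n * t ^ (n - 1))
      (M := fun n => n * T ^ (n - 1) + n * T ^ (n - 1)) ?_ ?_ (fun n => ?_) ?_
    · simpa only [add_mul] using hsT'.add hsT'
    · filter_upwards [eventually_mem_nhdsWithin] with s hs n
      exact (abs_sub _ _).trans (add_le_add (hpow' s hs n) (hpow' t ht n))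
    · have hcont : Continuous fun s : ℝ => (n : ℝ) * s ^ (n - 1) - n * t ^ (n - 1) := by fun_prop
      have h1 := hcont.tendsto t
      rw [sub_self] at h1
      exact h1.mono_left nhdsWithin_le_nhds
    · filter_upwards [eventually_mem_nhdsWithin] with s hs
      ext x
      rw [← ((sumv s hs x).sub (sumv t ht x)).tsum_eq]
      congr 1
      ext n
      ring
  · intro t ht x
    have hnorm : ∀ g : ℕ → ℝ, (∀ n, |g n| ≤ C * q ^ n * (1 + 1 / σ)) →
        Summable fun n : ℕ => ‖t ^ n * g n‖ := fun g hg => by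
      refine Summable.of_nonneg_of_le (fun n => norm_nonneg _) (fun n => ?_)
        ((hsu t ht).mul_left (C * (1 + 1 / σ)))
      rw [norm_mul, Real.norm_eq_abs, Real.norm_eq_abs]
      calc |t ^ n| * |g n| ≤ |t ^ n| * (C * q ^ n * (1 + 1 / σ)) := by gcongr; exact hg n
        _ = _ := by ring
    have hσi : 0 < 1 / σ := by positivity
    have n1 := hnorm (fun n => w n x) fun n => by
      have := (hw n).abs_le 0 x
      simp only [iteratedDeriv_zero, Nat.factorial_zero, pow_zero, Nat.cast_one, one_mul,
        mul_one] at this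
      have hCq : 0 ≤ C * q ^ n := by positivity
      nlinarith
    have n2 := hnorm (fun n => deriv (w n) x) fun n => by
      have := (hw n).abs_le 1 x
      simp only [iteratedDeriv_one, Nat.factorial_one, pow_one, Nat.cast_one, one_mul] at this
      have hCq : 0 ≤ C * q ^ n := by positivity
      nlinarith
    have hprod := tsum_mul_tsum_eq_tsum_sum_antidiagonal_of_summable_norm n1 n2
    rw [(sumu t ht x).tsum_eq, (sumu' t ht x).tsum_eq] at hprod
    have hv' : v t x = ∑' n : ℕ, (((n + 1 : ℕ) : ℝ) * t ^ (n + 1 - 1)) * w (n + 1) x := by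
      rw [← (sumv t ht x).tsum_eq, (sumv t ht x).summable.tsum_eq_zero_add]
      simp
    rw [hv', hprod, ← neg_eq_iff_add_eq_zero, ← tsum_neg]
    congr 1
    ext n
    have hrec := timeCoeff_recursion (fun n => (hw n).isHInf) n x
    rw [Nat.add_sub_cancel]
    push_cast
    calc -(((n : ℝ) + 1) * t ^ n * w (n + 1) x) = t ^ n * -(((n : ℝ) + 1) * w (n + 1) x) := by ring
      _ = t ^ n * ∑ p ∈ Finset.HasAntidiagonal.antidiagonal n, w p.1 x * deriv (w p.2) x := by
          rw [hrec, neg_neg]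
      _ = _ := by
          rw [Finset.mul_sum]
          refine Finset.sum_congr rfl fun p hp => ?_
          rw [← Finset.HasAntidiagonal.mem_antidiagonal.1 hp, pow_add]
          ring

/-! ### Choice of the constants -/

lemma H2Norm_nonneg (f : ℝ → ℝ) : 0 ≤ H2Norm f := Finset.sum_nonneg fun n _ => derivNorm_nonneg n f

lemma supH2_nonneg (T : ℝ) (u : ℝ → ℝ → ℝ) : 0 ≤ supH2 T u :=
  Real.sSup_nonneg (by rintro _ ⟨t, -, rfl⟩; exact H2Norm_nonneg _)

lemma supH2_le {T m : ℝ} {u : ℝ → ℝ → ℝ} (hm : 0 ≤ m) (h : ∀ t ∈ Icc 0 T, H2Norm (u t) ≤ m) :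
    supH2 T u ≤ m :=
  Real.sSup_le (by rintro _ ⟨t, ht, rfl⟩; exact h t ht) hm

lemma MemB.H2Norm_le {α ρ : ℝ} (hα : 0 ≤ α) (hρ : 0 < ρ) {f : ℝ → ℝ} (h : MemB α ρ f) :
    H2Norm f ≤ (1 + 1 / ρ + 2 / ρ ^ 2) * BNorm α ρ f := by
  have h0 := h.derivNorm_le_unweighted hα hρ 0
  have h1 := h.derivNorm_le_unweighted hα hρ 1
  have h2 := h.derivNorm_le_unweighted hα hρ 2
  simp only [H2Norm, Finset.sum_range_succ, Finset.sum_range_zero, zero_add]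
  refine (add_le_add (add_le_add h0 h1) h2).trans_eq ?_
  simp
  ring

lemma IsHInf.abs_deriv_le_H2Norm {f : ℝ → ℝ} (hf : IsHInf f) (x : ℝ) :
    |_root_.deriv f x| ≤ H2Norm f := by
  have h := hf.abs_le 1 x
  have h0 := derivNorm_nonneg 0 f
  rw [iteratedDeriv_one] at h
  simp only [H2Norm, Finset.sum_range_succ, Finset.sum_range_zero, zero_add]
  linarith

/-- A solution that obeys the bounds of radius `R` lives in `B_{α,R/4}`, with control of the
norm. -/
lemma IsC1Curve.isC1Curve_quarter_radius {α ρ T : ℝ} {u v : ℝ → ℝ → ℝ}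
    (h : IsC1Curve α ρ T u v) (hα : 0 ≤ α) (hρ : 0 < ρ)
    (hb : ∀ t ∈ Icc 0 T, ∀ x, v t x + u t x * deriv (u t) x = 0) {A R : ℝ} (hA : 0 ≤ A)
    (hR : 0 < R) (hU : ∀ t ∈ Icc 0 T, ∀ J : ℕ,
      derivNorm J (u t) ≤ A * ((J.factorial : ℝ) / weight α J) * (1 / R ^ J)) :
    IsC1Curve α (R / 4) T u v ∧ (∀ t ∈ Icc 0 T, AnalyticOnNhd ℝ (u t) univ) ∧
      ∀ t ∈ Icc 0 T, BNorm α (R / 4) (u t) ≤ 2 * A := by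
  have hU' : ∀ t ∈ Icc 0 T, ∀ J : ℕ, derivNorm J (u t) ≤ A * (J.factorial / R ^ J) :=
    fun t ht J => by
      refine (hU t ht J).trans ?_
      have h2 : (J.factorial : ℝ) / weight α J ≤ J.factorial :=
        div_le_self (by positivity) (one_le_weight hα J)
      calc A * ((J.factorial : ℝ) / weight α J) * (1 / R ^ J)
          ≤ A * (J.factorial : ℝ) * (1 / R ^ J) := by gcongr
        _ = _ := by ring
  have hV : ∀ t ∈ Icc 0 T, ∀ n : ℕ, derivNorm n (v t) ≤
      A ^ 2 * (1 + 1 / R) / R * ((n + 1) ^ 3 * (n.factorial / R ^ n)) := fun t ht n => by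
    have hv : v t = fun x => -(u t x * deriv (u t) x) := by
      ext x; linarith [hb t ht x]
    rw [hv]
    exact (h.mem t ht).isHInf.derivNorm_burgers_le hR hA (hU' t ht) n
  have eU : ∀ n : ℕ, A * ((n.factorial : ℝ) / weight α n) * (1 / R ^ n) / (n.factorial : ℝ) *
      weight α n * (R / 4) ^ n = A * (1 / 4) ^ n := fun n => by
    have hn : (0 : ℝ) < n.factorial := by exact_mod_cast n.factorial_pos
    have hw := weight_pos α n
    rw [div_pow, div_pow]
    field_simp
    simp
  have hgeo : HasSum (fun n : ℕ => A * (1 / 4 : ℝ) ^ n) (A * (1 - 1 / 4)⁻¹) :=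
    (hasSum_geometric_of_lt_one (by norm_num) (by norm_num)).mul_left A
  have sU : Summable fun n : ℕ => A * ((n.factorial : ℝ) / weight α n) * (1 / R ^ n) /
      (n.factorial : ℝ) * weight α n * (R / 4) ^ n :=
    hgeo.summable.congr fun n => (eU n).symm
  have sV : Summable fun n : ℕ => A ^ 2 * (1 + 1 / R) / R * ((n + 1) ^ 3 * (n.factorial / R ^ n)) /
      (n.factorial : ℝ) * weight α n * (R / 4) ^ n := by
    refine ((summable_pow_mul_weight_mul_geometric α 3 (x := 1 / 4) (by norm_num)
      (by norm_num)).mul_left (A ^ 2 * (1 + 1 / R) / R)).congr fun n => ?_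
    have hn : (0 : ℝ) < n.factorial := by exact_mod_cast n.factorial_pos
    rw [div_pow, div_pow]
    field_simp
    simp
  have hC := h.change_radius hρ (by positivity : 0 ≤ R / 4) hU hV sU sV
  refine ⟨hC, fun t ht => (h.mem t ht).isHInf.analyticOnNhd_of_le hR hA (hU' t ht),
    fun t ht => ?_⟩
  have h1 : BNorm α (R / 4) (u t) ≤ A * (1 - 1 / 4)⁻¹ := by
    rw [← hgeo.tsum_eq]
    refine (hC.mem t ht).summable.tsum_le_tsum (fun n => ?_) hgeo.summable
    exact (BTerm_mono (by positivity) (hU t ht n)).trans_eq (eU n)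
  norm_num at h1
  linarith

end Burgers

end

theorem theorem4p3 :
    -- `c` is the absolute constant of the energy estimate that fixes the time `T`
    ∃ c : ℝ, 0 < c ∧
    ∀ α ρ₀ c₀ : ℝ, 2 < α → 0 < ρ₀ → 1 < c₀ →
    ∃ c₃ c₄ : ℝ, c₀ ≤ c₃ ∧ 0 < c₄ ∧
    ∀ Θ M : ℝ, 0 < Θ → 0 < M →
    -- `r` is the radius `ρ''`; it, `δ = γ - γ₀` and `C` are chosen before `u₀`, `T`, `Tₐ`, `u`
    ∃ r δ C : ℝ, 0 < r ∧ r < ρ₀ ∧ 0 < δ ∧ c₀ * M ≤ C ∧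
    ∀ u₀ : ℝ → ℝ, Burgers.MemB α ρ₀ u₀ → Burgers.BNorm α ρ₀ u₀ ≤ M →
      -- local analytic solutions exist
      (∀ ρ : ℝ, 0 < ρ → ρ < ρ₀ → ∃ Tₐ : ℝ, 0 < Tₐ ∧
        ∃ u : ℝ → ℝ → ℝ, Burgers.IsSolution α ρ Tₐ u₀ u) ∧
      -- and each of them, whatever its `Tₐ` and `ρ`, is controlled on `[0, min Tₐ T]`
      (∀ T : ℝ, 0 < T → T ≤ Θ → c * c₀ * Burgers.H2Norm u₀ * T ≤ Real.log c₀ →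
        ∀ (Tₐ ρ : ℝ) (u : ℝ → ℝ → ℝ), 0 < Tₐ → 0 < ρ → Burgers.IsSolution α ρ Tₐ u₀ u →
          Burgers.IsSolution α r (min Tₐ T) u₀ u ∧
          ∀ t ∈ Set.Icc 0 (min Tₐ T),
            AnalyticOnNhd ℝ (u t) Set.univ ∧
            Burgers.MemB α r (u t) ∧
            Burgers.BNorm α r (u t) ≤ c₄ * Burgers.BNorm α ρ₀ u₀ ∧
            Burgers.H2Norm (u t) ≤ c₀ * Burgers.H2Norm u₀ ∧
            -- derivative estimate, constant linear in the data, exponent `(J - 2)₊`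
            (∀ J : ℕ, Burgers.derivNorm J (u t) ≤
              c₃ * Burgers.BNorm α ρ₀ u₀ *
                Real.exp (max ((J : ℝ) - 2) 0 * (Burgers.supH2 (min Tₐ T) u + δ) * t) *
                ((J.factorial : ℝ) / Burgers.weight α J) * (1 / ρ₀ ^ J)) ∧
            -- derivative estimate, exponent `J - 2` for every `J`
            (∀ J : ℕ, Burgers.derivNorm J (u t) ≤
              C * Real.exp (((J : ℝ) - 2) * (Burgers.supH2 (min Tₐ T) u + δ) * t) *
                ((J.factorial : ℝ) / Burgers.weight α J) * (1 / ρ₀ ^ J))) := by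
  refine ⟨100, by norm_num, fun α ρ₀ c₀ hα hρ₀ hc₀ => ⟨c₀, 2 * c₀, le_rfl, by linarith,
    fun Θ M hΘ hM => ?_⟩⟩
  have hα0 : 0 ≤ α := by linarith
  have hc0 : 0 < c₀ := by linarith
  obtain ⟨K, hK0, hK⟩ := Burgers.exists_convolutionBound hα
  -- `m` bounds `‖u‖_{H²}`, hence also the slope, on the whole time interval
  set m : ℝ := c₀ * ((1 + 1 / ρ₀ + 2 / ρ₀ ^ 2) * M) with hm
  have hm0 : 0 < m := by positivity
  set κ : ℝ := K * (1 + 2 / ρ₀) / ρ₀ with hκ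
  have hκ0 : 0 < κ := by positivity
  set δ : ℝ := 9 * m + 6 * (c₀ * M) * κ + 1 with hδ
  have hδ0 : 0 < δ := by positivity
  -- `G` bounds the exponent `γ t`
  set G : ℝ := (m + δ) * Θ with hG
  have hG0 : 0 < G := by positivity
  set R : ℝ := ρ₀ * Real.exp (-G) with hR
  have hR0 : 0 < R := by positivity
  have hRρ : R ≤ ρ₀ := by
    have : Real.exp (-G) ≤ 1 := Real.exp_le_one_iff.2 (by linarith)
    calc R ≤ ρ₀ * 1 := by rw [hR]; gcongr
      _ = ρ₀ := mul_one _
  refine ⟨R / 4, δ, c₀ * M * Real.exp (2 * G), by positivity, by linarith, hδ0, ?_,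
    fun u₀ hu₀ hM₀ => ⟨fun ρ hρ hρρ₀ => Burgers.exists_isSolution hα0 hρ hρρ₀ hu₀, ?_⟩⟩
  · exact le_mul_of_one_le_right (by positivity) (Real.one_le_exp (by linarith))
  intro T hT hTΘ hTc Tₐ ρ u hTₐ hρ hu
  set S := min Tₐ T with hS
  have hS0 : 0 < S := lt_min hTₐ hT
  obtain ⟨hu0, v, hC1, hb⟩ := hu
  replace hC1 := hC1.restrict (min_le_left Tₐ T)
  replace hb : ∀ t ∈ Set.Icc 0 S, ∀ x, v t x + u t x * deriv (u t) x = 0 :=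
    fun t ht => hb t ⟨ht.1, ht.2.trans (min_le_left _ _)⟩
  subst hu0
  set N := Burgers.BNorm α ρ₀ (u 0) with hN
  have hN0 : 0 ≤ N := Burgers.BNorm_nonneg α hρ₀.le _
  have hHn := Burgers.H2Norm_nonneg (u 0)
  have hSc : 100 * c₀ * Burgers.H2Norm (u 0) * S ≤ Real.log c₀ := by
    refine le_trans ?_ hTc
    have : S ≤ T := min_le_right _ _
    gcongr
  have hlow : ∀ n ≤ 2, ∀ t ∈ Set.Icc 0 S,
      Burgers.derivNorm n (u t) ≤ c₀ * Burgers.derivNorm n (u 0) :=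
    fun n hn => hC1.derivNorm_le_of_le_two hρ hb hS0 hc₀ hSc hn
  have hH2 : ∀ t ∈ Set.Icc 0 S, Burgers.H2Norm (u t) ≤ c₀ * Burgers.H2Norm (u 0) := by
    intro t ht
    unfold Burgers.H2Norm
    rw [Finset.mul_sum]
    exact Finset.sum_le_sum fun n hn => hlow n (by have := Finset.mem_range.1 hn; omega) t ht
  have hH2m : ∀ t ∈ Set.Icc 0 S, Burgers.H2Norm (u t) ≤ m := by
    intro t ht
    refine (hH2 t ht).trans ?_
    rw [hm]
    gcongr
    refine (hu₀.H2Norm_le hα0 hρ₀).trans ?_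
    gcongr
  set Δ := Burgers.supH2 S u + δ with hΔ
  have hΔδ : δ ≤ Δ := by have := Burgers.supH2_nonneg S u; linarith
  have hΔm : Δ ≤ m + δ := by have := Burgers.supH2_le hm0.le hH2m; linarith
  have hΔ0 : 0 ≤ Δ := by linarith
  have hdata : ∀ J, Burgers.derivNorm J (u 0) ≤
      N * ((J.factorial : ℝ) / Burgers.weight α J) * (1 / ρ₀ ^ J) := hu₀.derivNorm_le hρ₀
  have hΔt : ∀ t ∈ Set.Icc 0 S, 0 ≤ Δ * t ∧ Δ * t ≤ G := fun t ht =>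
    ⟨mul_nonneg hΔ0 ht.1, by
      have : t ≤ Θ := ht.2.trans ((min_le_right _ _).trans hTΘ)
      have := ht.1
      rw [hG]
      gcongr⟩
  have hmain := hC1.derivNorm_le_exp_max hρ hb hα hρ₀ (A := c₀ * N) (Δ := Δ) (by positivity) hK0
    hK hm0.le (fun t ht x => ((hC1.mem t ht).isHInf.abs_deriv_le_H2Norm x).trans (hH2m t ht))
    (by
      have : 6 * (c₀ * N) * κ ≤ 6 * (c₀ * M) * κ := by gcongr
      linarith)
    (fun J => (hdata J).trans (by
      have := Burgers.weight_pos α J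
      have : N ≤ c₀ * N := le_mul_of_one_le_left hN0 hc₀.le
      gcongr))
    (fun J hJ t ht => (hlow J hJ t ht).trans (by
      calc _ ≤ c₀ * (N * ((J.factorial : ℝ) / Burgers.weight α J) * (1 / ρ₀ ^ J)) := by
            gcongr; exact hdata J
        _ = _ := by ring))
  have hU : ∀ t ∈ Set.Icc 0 S, ∀ J : ℕ, Burgers.derivNorm J (u t) ≤
      c₀ * N * ((J.factorial : ℝ) / Burgers.weight α J) * (1 / R ^ J) := by
    intro t ht J
    refine (hmain J t ht).trans ?_
    have hw := Burgers.weight_pos α J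
    have hexp : Real.exp (max ((J : ℝ) - 2) 0 * Δ * t) ≤ Real.exp G ^ J := by
      rw [← Real.exp_nat_mul, mul_assoc]
      refine Real.exp_le_exp.2 ?_
      have h1 : max ((J : ℝ) - 2) 0 ≤ J := max_le (by linarith) (by positivity)
      exact mul_le_mul h1 (hΔt t ht).2 (hΔt t ht).1 (by positivity)
    have hRJ : 1 / R ^ J = Real.exp G ^ J * (1 / ρ₀ ^ J) := by
      rw [hR, Real.exp_neg, mul_pow, inv_pow]
      field_simp
    rw [hRJ]
    calc _ ≤ c₀ * N * Real.exp G ^ J * ((J.factorial : ℝ) / Burgers.weight α J) *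
          (1 / ρ₀ ^ J) := by gcongr
      _ = _ := by ring
  obtain ⟨hC1r, hana, hBn⟩ := hC1.isC1Curve_quarter_radius hα0 hρ hb (by positivity) hR0 hU
  refine ⟨⟨rfl, v, hC1r, hb⟩, fun t ht => ⟨hana t ht, hC1r.mem t ht,
    (hBn t ht).trans_eq (by ring), hH2 t ht, fun J => hmain J t ht, fun J => ?_⟩⟩
  refine (hmain J t ht).trans ?_
  have hw := Burgers.weight_pos α J
  -- for `J < 2` the exponent `J - 2` is negative; the factor `exp (2 G)` in `C` makes up for it
  have hexp : Real.exp (max ((J : ℝ) - 2) 0 * Δ * t) ≤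
      Real.exp (2 * G) * Real.exp (((J : ℝ) - 2) * Δ * t) := by
    rw [← Real.exp_add]
    refine Real.exp_le_exp.2 ?_
    rw [mul_assoc, mul_assoc]
    obtain ⟨h1, h2⟩ := hΔt t ht
    have hJ0 : (0 : ℝ) ≤ J := J.cast_nonneg
    rcases max_cases ((J : ℝ) - 2) 0 with ⟨h3, -⟩ | ⟨h3, -⟩ <;> rw [h3]
    · linarith
    · nlinarith
  calc _ ≤ c₀ * M * (Real.exp (2 * G) * Real.exp (((J : ℝ) - 2) * Δ * t)) *
        ((J.factorial : ℝ) / Burgers.weight α J) * (1 / ρ₀ ^ J) := by gcongr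
    _ = _ := by ring
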